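/- Let $Q$ be a finite quiver (loops and multiple arrows allowed) with vertex set $Q_0$ and arrow set $Q_1$, and let $q\in(\mathbb{C}^\times)^{Q_0}$ and $\theta\in\mathbb{Z}^{Q_0}$. **Notation.** Let $e_i$ be the coordinate vector at $i$. Put $\langle\alpha,\beta\rangle=\sum_{i\in Q_0}\alpha_i\beta_i-\sum_{a\in Q_1}\alpha_{t(a)}\beta_{h(a)}$, $(\alpha,\beta)=\langle\alpha,\beta\rangle+\langle\beta,\alpha\rangle$, $p(\alpha)=1-\langle\alpha,\alpha\rangle$ and $q^\alpha=\prod_i q_i^{\alpha_i}$. Let $\mathcal{F}(Q)$ be the set of nonzero $\alpha\in\mathbb{N}^{Q_0}$ with connected support and $(\alpha,e_i)\le 0$ for all $i$. At a loopfree vertex $v$ there is the reflection $(q,\theta,\alpha)\mapsto(u_v(q),r_v(\theta),s_v(\alpha))$, where $$s_v(\alpha)=\alpha-(\alpha,e_v)e_v,\qquad u_v(q)_w=q_v^{-(e_v,e_w)}q_w,\qquad r_v(\theta)_w=\theta_w-(e_v,e_w)\theta_v.$$ It is *admissible* if $q_v\ne 1$ or $\theta_v\neq 0$, and it is a *$(-1)$-reflection*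 if $s_v(\alpha)=\alpha-e_v$. Real (respectively imaginary) roots are the vectors obtained from the coordinate vectors at loopfree vertices (respectively from $\pm$ elements of $\mathcal{F}(Q)$) by sequences of reflections $s_v$ at loopfree vertices, and $R^+$ is the set of all roots in $\mathbb{N}^{Q_0}$. Let $N_{q,\theta}=\{\alpha\in\mathbb{N}^{Q_0}: q^\alpha=1,\ \alpha\cdot\theta=0\}$ and $R^+_{q,\theta}=R^+\cap N_{q,\theta}$. Let $\Sigma_{q,\theta}$ be the set of $\alpha\in R^+_{q,\theta}$ such that $p(\alpha)>\sum_{i=1}^r p(\beta^{(i)})$ for every decomposition $\alpha=\beta^{(1)}+\dots+\beta^{(r)}$ with $r\ge2$ and all $\beta^{(i)}\in R^+_{q,\theta}$. Let $\widetilde\Sigma_{q,\theta}$, the set of *flat* vectors, be the set of $\alpha\in N_{q,\theta}$ such that $p(\alpha)\ge\sum_{i=1}^r p(\beta^{(i)})$ for every decomposition $\alpha=\beta^{(1)}+\dots+\beta^{(r)}$ with all $\beta^{(i)}\in R^+_{q,\theta}$. A *reflecting sequence* for $(q,\theta,\alpha)$ is a finite, possibly empty, sequence $v_1,\dots,v_m$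 of loopfree vertices such that the triples $(q^{(0)},\theta^{(0)},\alpha^{(0)})=(q,\theta,\alpha)$ and $(q^{(i)},\theta^{(i)},\alpha^{(i)})=(u_{v_i}(q^{(i-1)}),r_{v_i}(\theta^{(i-1)}),s_{v_i}(\alpha^{(i-1)}))$ satisfy $\alpha^{(i)}_{v_i}<\alpha^{(i-1)}_{v_i}$ for $1\le i\le m$ and $\alpha^{(m)}\in\mathcal{F}(Q)\cup\{e_v: v\in Q_0\}$. For $J\subseteq Q_0$ let $Q|_J$ be the full subquiver on $J$, and let $\alpha|_J$ be $\alpha$ with its entries outside $J$ replaced by $0$. The quiver $Q|_J$ is *affine Dynkin* if it is connected and its form $\langle x,x\rangle$ is positive semidefinite but not positive definite, that is, if it is of type $\widetilde A_n$ ($n\ge0$; $\widetilde A_0$ is one vertex with one loop), $\widetilde D_n$ ($n\geq 4$), $\widetilde E_6$, $\widetilde E_7$ or $\widetilde E_8$. Its unique indivisible positive imaginary root is denoted $\delta$, and $j\in J$ is an *extending vertex* if $\delta_j=1$. **Theorem.** Every $\alpha\in R^+_{q,\theta}$ has a reflecting sequence. For every $\alpha\in R^+_{q,\theta}$ and every reflecting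 sequence for $(q,\theta,\alpha)$, with last triple $(q',\theta',\alpha')=(q^{(m)},\theta^{(m)},\alpha^{(m)})$, the following hold. 1. $\alpha\notin\Sigma_{q,\theta}$ if and only if one of the reflections in the sequence is not admissible, or $\alpha'$ is of one of the following forms: - (a) $\alpha'=m\ell\delta$, where $\delta$ is the indivisible positive imaginary root of an affine Dynkin full subquiver of $Q$, $m\ge2$, and $\ell\ge1$ is such that $(q')^\delta$ is a primitive $\ell$-th root of unity; - (b) the support of $\alpha'$ is a disjoint union $J\sqcup K$, there is exactly one arrow (in either direction) between $J$ and $K$, it joins a vertex $j\in J$ and a vertex $k\in K$, $\alpha'_k=1$, and either - (b1) $\alpha'_j=1$ and $\alpha'|_J\in R^+_{q',\theta'}$, or - (b2) $Q|_J$ is affine Dynkin with extending vertex $j$, $\alpha'|_J=m\delta$ for some $m\ge2$, and $\delta\in R^+_{q',\theta'}$. 2. $\alpha\notin\widetilde\Sigma_{q,\theta}$ if and only if one of the reflections in the sequence is neither admissible nor a $(-1)$-reflection, or $\alpha'$ is of the form (a). -/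

import Mathlib

universe u w

noncomputable section

namespace MultQuiver

section Basics

variable {V : Type u} [Fintype V] [DecidableEq V] [Quiver.{w} V] [∀ i j : V, Fintype (i ⟶ j)]

/-- The Euler (Ringel) form `⟨α, β⟩ = ∑ᵢ αᵢ βᵢ - ∑ₐ α_{t(a)} β_{h(a)}` of a finite quiver on the
vertex set `V`; arrows `a` with tail `i` and head `j` are the elements of `i ⟶ j`. -/
def eulerForm (α β : V → ℤ) : ℤ :=
  ∑ i, α i * β i - ∑ i : V, ∑ j : V, ∑ _a : (i ⟶ j), α i * β j

/-- The Cartan (Tits) form `(α, β) = ⟨α, β⟩ + ⟨β, α⟩`. -/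
def cartanForm (α β : V → ℤ) : ℤ := eulerForm α β + eulerForm β α

/-- `p(α) = 1 - ⟨α, α⟩`. -/
def pFun (α : V → ℤ) : ℤ := 1 - eulerForm α α

/-- The coordinate vector `e_v`. -/
def coordVec (v : V) : V → ℤ := Pi.single v 1

/-- The vertex `v` carries no loop. -/
def Loopfree (v : V) : Prop := IsEmpty (v ⟶ v)

/-- The reflection `s_v(α) = α - (α, e_v) e_v` on dimension vectors. -/
def reflectVec (v : V) (α : V → ℤ) : V → ℤ := α - cartanForm α (coordVec v) • coordVec v

/-- The reflection `u_v(q)_w = q_v ^ (-(e_v, e_w)) q_w`. -/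
def reflectQ (v : V) (q : V → ℂˣ) : V → ℂˣ :=
  fun w => q v ^ (-cartanForm (coordVec v) (coordVec w)) * q w

/-- The reflection `r_v(θ)_w = θ_w - (e_v, e_w) θ_v`. -/
def reflectTheta (v : V) (θ : V → ℤ) : V → ℤ :=
  fun w => θ w - cartanForm (coordVec v) (coordVec w) * θ v

/-- Successive application of the reflections at the vertices of a list, the head of the list
first. -/
def reflectVecList (vs : List V) (α : V → ℤ) : V → ℤ := vs.foldl (fun β v => reflectVec v β) α

variable (V) in
/-- The graph underlying the quiver, without loops and multiplicities. -/
def underlyingGraph : SimpleGraph V := SimpleGraph.fromRel fun i j : V => Nonempty (i ⟶ j)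

/-- The full subquiver on `J` is non-empty and connected. -/
def ConnectedOn (J : Set V) : Prop := ((underlyingGraph V).induce J).Connected

variable (V) in
/-- The fundamental region: nonzero `α ∈ ℕ^V` with connected support and `(α, e_i) ≤ 0` for
all `i`. -/
def fundamentalRegion : Set (V → ℤ) :=
  {α | 0 ≤ α ∧ α ≠ 0 ∧ ConnectedOn (Function.support α) ∧ ∀ i, cartanForm α (coordVec i) ≤ 0}

/-- Real roots: obtained from the coordinate vector at a loopfree vertex by a sequence of
reflections at loopfree vertices. -/
def IsRealRoot (α : V → ℤ) : Prop :=
  ∃ (v : V) (vs : List V), Loopfree v ∧ (∀ x ∈ vs, Loopfree x) ∧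
    α = reflectVecList vs (coordVec v)

/-- Imaginary roots: obtained from `±` an element of the fundamental region by a sequence of
reflections at loopfree vertices. -/
def IsImaginaryRoot (α : V → ℤ) : Prop :=
  ∃ f ∈ fundamentalRegion V, ∃ vs : List V, (∀ x ∈ vs, Loopfree x) ∧
    (α = reflectVecList vs f ∨ α = reflectVecList vs (-f))

variable (V) in
/-- The set `R⁺` of positive roots. -/
def positiveRoots : Set (V → ℤ) := {α | 0 ≤ α ∧ (IsRealRoot α ∨ IsImaginaryRoot α)}

/-- `q^α = ∏ᵢ qᵢ ^ αᵢ`. -/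
def qPow (q : V → ℂˣ) (α : V → ℤ) : ℂˣ := ∏ i, q i ^ α i

/-- `N_{q,θ} = {α ∈ ℕ^V : q^α = 1, α · θ = 0}`. -/
def NSet (q : V → ℂˣ) (θ : V → ℤ) : Set (V → ℤ) :=
  {α | 0 ≤ α ∧ qPow q α = 1 ∧ ∑ i, α i * θ i = 0}

/-- `R⁺_{q,θ} = R⁺ ∩ N_{q,θ}`. -/
def RPlus (q : V → ℂˣ) (θ : V → ℤ) : Set (V → ℤ) := positiveRoots V ∩ NSet q θ

/-- `Σ_{q,θ}`: those `α ∈ R⁺_{q,θ}` with `p(α) > ∑ p(β⁽ⁱ⁾)` for every decomposition of `α` as a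
sum of at least two elements `β⁽ⁱ⁾` of `R⁺_{q,θ}`. -/
def SigmaSet (q : V → ℂˣ) (θ : V → ℤ) : Set (V → ℤ) :=
  {α | α ∈ RPlus q θ ∧ ∀ βs : List (V → ℤ), 2 ≤ βs.length → (∀ β ∈ βs, β ∈ RPlus q θ) →
    βs.sum = α → (βs.map pFun).sum < pFun α}

/-- The set of flat vectors: those `α ∈ N_{q,θ}` with `p(α) ≥ ∑ p(α⁽ⁱ⁾)` for every decomposition
of `α` as a sum of elements `α⁽ⁱ⁾` of `R⁺_{q,θ}`. -/
def FlatSet (q : V → ℂˣ) (θ : V → ℤ) : Set (V → ℤ) :=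
  {α | α ∈ NSet q θ ∧ ∀ βs : List (V → ℤ), (∀ β ∈ βs, β ∈ RPlus q θ) →
    βs.sum = α → (βs.map pFun).sum ≤ pFun α}

end Basics

section Reflecting

/-- A triple `(q, θ, α)`. -/
@[ext]
structure Triple (V : Type u) where
  q : V → ℂˣ
  θ : V → ℤ
  α : V → ℤ

variable {V : Type u} [Fintype V] [DecidableEq V] [Quiver.{w} V] [∀ i j : V, Fintype (i ⟶ j)]

/-- The reflection `(q, θ, α) ↦ (u_v(q), r_v(θ), s_v(α))`. -/
def Triple.reflect (t : Triple V) (v : V) : Triple V :=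
  ⟨reflectQ v t.q, reflectTheta v t.θ, reflectVec v t.α⟩

/-- The triple `(q⁽ⁱ⁾, θ⁽ⁱ⁾, α⁽ⁱ⁾)` obtained after the first `i` reflections of the sequence
`vs`. -/
def Triple.after (t : Triple V) (vs : List V) (i : ℕ) : Triple V :=
  (vs.take i).foldl Triple.reflect t

/-- The triple obtained after all reflections of the sequence `vs`. -/
def Triple.final (t : Triple V) (vs : List V) : Triple V := t.after vs vs.length

/-- The reflection of the triple `t` at `v` is admissible. -/
def Triple.Admissible (t : Triple V) (v : V) : Prop := t.θ v ≠ 0 ∨ t.q v ≠ 1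

/-- The reflection of the triple `t` at `v` is a `(-1)`-reflection: `s_v(α) = α - e_v`. -/
def Triple.MinusOne (t : Triple V) (v : V) : Prop := reflectVec v t.α = t.α - coordVec v

/-- `vs = (v₁, …, v_m)` is a reflecting sequence for `t = (q, θ, α)`: the `v_i` are loopfree, the
resulting vector lies in the fundamental region or is a coordinate vector, and each reflection
lowers the entry at its vertex. The `i`-th entry `vs[i]` (counted from `0`) is applied to
`t.after vs i` and gives `t.after vs (i + 1)`. -/
def Triple.IsReflectingSequence (t : Triple V) (vs : List V) : Prop :=
  (∀ v ∈ vs, Loopfree v) ∧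
  ((t.final vs).α ∈ fundamentalRegion V ∨ ∃ v, (t.final vs).α = coordVec v) ∧
  ∀ i : Fin vs.length, (t.after vs (i + 1)).α vs[i] < (t.after vs i).α vs[i]

/-- The full subquiver on `J` is affine (extended) Dynkin: it is non-empty and connected, and its
Tits form is positive semidefinite but not positive definite. As loops and multiple arrows are
allowed, this gives the types `Ã_n` (`n ≥ 0`, where `Ã_0` is one vertex with one loop and `Ã_1` is
two vertices with two arrows), `D̃_n` (`n ≥ 4`), `Ẽ_6`, `Ẽ_7`, `Ẽ_8`, with any orientation. -/
def IsAffineDynkinOn (J : Set V) : Prop :=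
  ConnectedOn J ∧
  (∀ x : V → ℤ, Function.support x ⊆ J → 0 ≤ eulerForm x x) ∧
  ∃ x : V → ℤ, Function.support x ⊆ J ∧ x ≠ 0 ∧ eulerForm x x = 0

/-- `δ` is an indivisible positive imaginary root supported on `J`. If the full subquiver on `J`
is affine Dynkin, there is exactly one. -/
def IsIndivImaginaryRootOn (J : Set V) (δ : V → ℤ) : Prop :=
  0 ≤ δ ∧ IsImaginaryRoot δ ∧ Function.support δ ⊆ J ∧ Finset.univ.gcd δ = 1

/-- There is exactly one arrow with one end in `J` and the other end in `K`, and its ends are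
`j ∈ J` and `k ∈ K`. -/
def UniqueArrowBetween (J K : Set V) (j k : V) : Prop :=
  j ∈ J ∧ k ∈ K ∧ ∀ x ∈ J, ∀ y ∈ K,
    Fintype.card (x ⟶ y) + Fintype.card (y ⟶ x) = if x = j ∧ y = k then 1 else 0

/-- Case (a): `α = mℓδ` with `δ` the indivisible imaginary root of an affine Dynkin full
subquiver, `m ≥ 2`, and `q^δ` a primitive `ℓ`-th root of unity. -/
def Triple.CaseA (t : Triple V) : Prop :=
  ∃ (J : Set V) (δ : V → ℤ) (m ℓ : ℕ), IsAffineDynkinOn J ∧ IsIndivImaginaryRootOn J δ ∧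
    2 ≤ m ∧ 1 ≤ ℓ ∧ IsPrimitiveRoot (qPow t.q δ) ℓ ∧ t.α = (m * ℓ) • δ

/-- Condition (b1), for a splitting with unique arrow between `j ∈ J` and `k`:
`α_j = 1` and `α|_J ∈ R⁺_{q,θ}`. -/
def Triple.CaseB1 (t : Triple V) (J : Set V) (j : V) : Prop :=
  t.α j = 1 ∧ J.indicator t.α ∈ RPlus t.q t.θ

/-- Condition (b2), for a splitting with unique arrow between `j ∈ J` and `k`: the full subquiver
on `J` is affine Dynkin, with indivisible imaginary root `δ ∈ R⁺_{q,θ}`, the vertex `j` is an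
extending vertex of it (that is, `δ_j = 1`), and `α|_J = mδ` with `m ≥ 2`. -/
def Triple.CaseB2 (t : Triple V) (J : Set V) (j : V) : Prop :=
  IsAffineDynkinOn J ∧ ∃ (δ : V → ℤ) (m : ℕ), IsIndivImaginaryRootOn J δ ∧ δ ∈ RPlus t.q t.θ ∧
    δ j = 1 ∧ 2 ≤ m ∧ J.indicator t.α = m • δ

/-- Case (b): the support of `α` is `J ⊔ K` with exactly one arrow between `J` and `K`, with ends
`j ∈ J` and `k ∈ K`, `α_k = 1`, and (b1) or (b2) holds. -/
def Triple.CaseB (t : Triple V) : Prop :=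
  ∃ (J K : Set V) (j k : V), Disjoint J K ∧ Function.support t.α = J ∪ K ∧
    UniqueArrowBetween J K j k ∧ t.α k = 1 ∧ (t.CaseB1 J j ∨ t.CaseB2 J j)

end Reflecting

end MultQuiver

end

set_option linter.unusedSectionVars false

noncomputable section

namespace MultQuiver

/-! The theorem is proved by induction along the reflecting sequence, followed by an analysis of the
last vector.

Reflections. The map s_v preserves p and carries R⁺_{q,θ} without e_v onto the corresponding set for
the reflected parameters. If e_v ∉ N_{q,θ} (the admissible case), decompositions correspond one to
one, and neither membership changes. Otherwise the parameters are fixed and p(e_v) = 0. Put n = (α,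
e_v). Then α = s_v(α) + n e_v has the same total p, so α ∉ Σ. For n ≥ 2 the root s_v(α) + e_v has
larger p than α, so α is not flat. For n = 1 flatness of α and of s_v(α) are equivalent
(`notMem_iff_of_isReflectingSequence`).

Fundamental region. By p(x + y) = p(x) + p(y) - 1 - (x, y), and because two positive roots with
negative pairing add up to a root (`IncRoot.add`), summands with negative pairing can be merged
without lowering the total p (`exists_split`). Merging a decomposition with ∑ p ≥ p(α) ends in one
of two ways. Either some summand β has (β, α - β) ≥ 0. Kac's inequality (`kac_inequality`) then
makes β proportional to α and α radical on its support, which is case (a). Or two roots β, γ with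
(β, γ) = -1 remain. If their supports are disjoint, a single arrow joins them: case (b1). Otherwise
the meet of β and γ is a null vector; it shrinks to the root δ of an affine subquiver, and case (b2)
follows (`Triple.caseB_of_split`). In this second outcome the original decomposition had ∑ p ≤ p(α),
so only (a) violates flatness.

All this needs positive roots that stay positive under s_v, apart from e_v. That is proved by
describing them through increasing reflections (`IncRoot`) and using the rank-two relations
(`IncRoot.reflectVec`). -/

variable {V : Type u} [Fintype V] [DecidableEq V] [Quiver.{w} V] [∀ i j : V, Fintype (i ⟶ j)]

/-! ### Bilinearity and sign properties of the forms. -/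

lemma eulerForm_add_left (x y z : V → ℤ) :
    eulerForm (x + y) z = eulerForm x z + eulerForm y z := by
  simp only [eulerForm, Pi.add_apply, add_mul, Finset.sum_add_distrib]; ring

lemma eulerForm_add_right (x y z : V → ℤ) :
    eulerForm x (y + z) = eulerForm x y + eulerForm x z := by
  simp only [eulerForm, Pi.add_apply, mul_add, Finset.sum_add_distrib]; ring

lemma eulerForm_smul_left (n : ℤ) (x y : V → ℤ) :
    eulerForm (n • x) y = n * eulerForm x y := by
  simp only [eulerForm, Pi.smul_apply, smul_eq_mul, mul_assoc, ← Finset.mul_sum]; ring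

lemma eulerForm_smul_right (n : ℤ) (x y : V → ℤ) :
    eulerForm x (n • y) = n * eulerForm x y := by
  simp only [eulerForm, Pi.smul_apply, smul_eq_mul, mul_left_comm _ n, ← Finset.mul_sum]; ring

lemma cartanForm_comm (x y : V → ℤ) : cartanForm x y = cartanForm y x := by
  simp only [cartanForm, add_comm]

lemma cartanForm_add_left (x y z : V → ℤ) :
    cartanForm (x + y) z = cartanForm x z + cartanForm y z := by
  simp only [cartanForm, eulerForm_add_left, eulerForm_add_right]; ring

lemma cartanForm_add_right (x y z : V → ℤ) :
    cartanForm x (y + z) = cartanForm x y + cartanForm x z := by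
  simp only [cartanForm, eulerForm_add_left, eulerForm_add_right]; ring

lemma cartanForm_smul_left (n : ℤ) (x y : V → ℤ) :
    cartanForm (n • x) y = n * cartanForm x y := by
  simp only [cartanForm, eulerForm_smul_left, eulerForm_smul_right]; ring

lemma cartanForm_smul_right (n : ℤ) (x y : V → ℤ) :
    cartanForm x (n • y) = n * cartanForm x y := by
  simp only [cartanForm, eulerForm_smul_left, eulerForm_smul_right]; ring

lemma cartanForm_neg_left (x y : V → ℤ) : cartanForm (-x) y = -cartanForm x y := by
  simpa using cartanForm_smul_left (-1) x y

lemma cartanForm_neg_right (x y : V → ℤ) : cartanForm x (-y) = -cartanForm x y := by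
  simpa using cartanForm_smul_right (-1) x y

lemma cartanForm_sub_left (x y z : V → ℤ) :
    cartanForm (x - y) z = cartanForm x z - cartanForm y z := by
  rw [sub_eq_add_neg, cartanForm_add_left, cartanForm_neg_left]; ring

lemma cartanForm_sub_right (x y z : V → ℤ) :
    cartanForm x (y - z) = cartanForm x y - cartanForm x z := by
  rw [sub_eq_add_neg, cartanForm_add_right, cartanForm_neg_right]; ring

lemma cartanForm_zero_left (x : V → ℤ) : cartanForm 0 x = 0 := by
  simpa using cartanForm_smul_left 0 x x

lemma cartanForm_zero_right (x : V → ℤ) : cartanForm x 0 = 0 := by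
  rw [cartanForm_comm, cartanForm_zero_left]

lemma cartanForm_finset_sum_right {ι : Type*} (s : Finset ι) (x : V → ℤ) (f : ι → V → ℤ) :
    cartanForm x (∑ i ∈ s, f i) = ∑ i ∈ s, cartanForm x (f i) := by
  classical
  induction s using Finset.induction_on with
  | empty => simp [cartanForm_zero_right]
  | insert a s ha ih => rw [Finset.sum_insert ha, Finset.sum_insert ha, cartanForm_add_right, ih]

lemma sum_smul_coordVec (x : V → ℤ) : ∑ i, x i • coordVec i = x := by
  funext j
  simp [coordVec, Finset.sum_apply, Pi.single_apply]

lemma cartanForm_eq_sum (x y : V → ℤ) :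
    cartanForm x y = ∑ i, y i * cartanForm x (coordVec i) := by
  conv_lhs => rw [← sum_smul_coordVec y]
  simp only [cartanForm_finset_sum_right, cartanForm_smul_right]

lemma cartanForm_coordVec_eq_sum (x : V → ℤ) (v : V) :
    cartanForm x (coordVec v) = ∑ i, x i * cartanForm (coordVec i) (coordVec v) := by
  rw [cartanForm_comm, cartanForm_eq_sum]
  simp only [cartanForm_comm (coordVec v)]

lemma cartanForm_self (x : V → ℤ) : cartanForm x x = 2 * eulerForm x x := by
  simp only [cartanForm]; ring

lemma even_cartanForm_self (x : V → ℤ) : Even (cartanForm x x) :=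
  ⟨eulerForm x x, by rw [cartanForm_self]; ring⟩

lemma eulerForm_coordVec (v w : V) :
    eulerForm (coordVec v) (coordVec w) = (if v = w then 1 else 0) - Fintype.card (v ⟶ w) := by
  have h1 : ∑ i, (coordVec v : V → ℤ) i * coordVec w i = if v = w then 1 else 0 := by
    simp [coordVec, Pi.single_apply, eq_comm]
  have h2 : ∑ i : V, ∑ j : V, ∑ _a : (i ⟶ j), (coordVec v : V → ℤ) i * coordVec w j
      = Fintype.card (v ⟶ w) := by
    rw [Finset.sum_eq_single v, Finset.sum_eq_single w]
    · simp [coordVec]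
    · intro b _ hb
      simp [coordVec, hb]
    · simp
    · intro b _ hb
      simp [coordVec, hb]
    · simp
  rw [eulerForm, h1, h2]

lemma cartanForm_coordVec_of_ne {v w : V} (h : v ≠ w) :
    cartanForm (coordVec v) (coordVec w)
      = -((Fintype.card (v ⟶ w) + Fintype.card (w ⟶ v) : ℕ) : ℤ) := by
  simp only [cartanForm, eulerForm_coordVec, h, h.symm, if_false]; push_cast; ring

lemma cartanForm_coordVec_nonpos {v w : V} (h : v ≠ w) :
    cartanForm (coordVec v) (coordVec w) ≤ 0 := by
  rw [cartanForm_coordVec_of_ne h]; omega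

lemma cartanForm_coordVec_self (v : V) :
    cartanForm (coordVec v) (coordVec v) = 2 - 2 * Fintype.card (v ⟶ v) := by
  simp only [cartanForm, eulerForm_coordVec, if_true]; ring

lemma Loopfree.cartanForm_self {v : V} (h : Loopfree v) :
    cartanForm (coordVec v) (coordVec v) = 2 := by
  have : IsEmpty (v ⟶ v) := h
  rw [cartanForm_coordVec_self, Fintype.card_eq_zero]; simp

lemma cartanForm_coordVec_self_nonpos {v : V} (h : ¬ Loopfree v) :
    cartanForm (coordVec v) (coordVec v) ≤ 0 := by
  have : Nonempty (v ⟶ v) := not_isEmpty_iff.mp h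
  have := Fintype.card_pos (α := (v ⟶ v))
  rw [cartanForm_coordVec_self]; omega

lemma coordVec_self (v : V) : (coordVec v : V → ℤ) v = 1 := by simp [coordVec]

lemma coordVec_of_ne {v w : V} (h : w ≠ v) : (coordVec v : V → ℤ) w = 0 := by simp [coordVec, h]

lemma coordVec_nonneg (v : V) : (0 : V → ℤ) ≤ coordVec v := by
  intro i
  by_cases h : i = v
  · subst h; simp [coordVec]
  · simp [coordVec, h]

lemma coordVec_ne_zero (v : V) : (coordVec v : V → ℤ) ≠ 0 := by
  intro h; have := congrFun h v; simp [coordVec] at this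

lemma coordVec_le {x : V → ℤ} (hx : 0 ≤ x) {v : V} (hv : 0 < x v) : coordVec v ≤ x := by
  intro i
  by_cases h : i = v
  · subst h; rw [coordVec_self]; exact hv
  · rw [coordVec_of_ne h]; exact hx i

/-- Off the diagonal the form is antitone. -/
lemma cartanForm_coordVec_anti {x y : V → ℤ} (h : x ≤ y) {v : V} (hv : x v = y v) :
    cartanForm y (coordVec v) ≤ cartanForm x (coordVec v) := by
  rw [cartanForm_coordVec_eq_sum, cartanForm_coordVec_eq_sum]
  refine Finset.sum_le_sum fun i _ => ?_
  by_cases hi : i = v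
  · subst hi; rw [hv]
  · exact mul_le_mul_of_nonpos_right (h i) (cartanForm_coordVec_nonpos hi)

lemma cartanForm_coordVec_nonpos_of_eq_zero {x : V → ℤ} (hx : 0 ≤ x) {v : V} (hv : x v = 0) :
    cartanForm x (coordVec v) ≤ 0 := by
  simpa [cartanForm_zero_left] using cartanForm_coordVec_anti hx (v := v) (by simp [hv])

lemma pos_of_cartanForm_pos {x : V → ℤ} (hx : 0 ≤ x) {v : V}
    (h : 0 < cartanForm x (coordVec v)) : 0 < x v := by
  rcases (hx v).lt_or_eq with h1 | h1
  · exact h1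
  · have := cartanForm_coordVec_nonpos_of_eq_zero hx h1.symm
    omega

lemma loopfree_of_cartanForm_pos {x : V → ℤ} (hx : 0 ≤ x) {v : V}
    (h : 0 < cartanForm x (coordVec v)) : Loopfree v := by
  by_contra hv
  have h1 := cartanForm_coordVec_self_nonpos hv
  have : cartanForm x (coordVec v) ≤ 0 := by
    rw [cartanForm_coordVec_eq_sum]
    refine Finset.sum_nonpos fun i _ => ?_
    by_cases hi : i = v
    · subst hi; exact mul_nonpos_of_nonneg_of_nonpos (hx i) h1
    · exact mul_nonpos_of_nonneg_of_nonpos (hx i) (cartanForm_coordVec_nonpos hi)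
  omega

lemma cartanForm_nonpos_of_disjoint {x y : V → ℤ} (hx : 0 ≤ x) (hy : 0 ≤ y)
    (h : ∀ i, x i = 0 ∨ y i = 0) : cartanForm x y ≤ 0 := by
  rw [cartanForm_eq_sum]
  refine Finset.sum_nonpos fun i _ => ?_
  rcases h i with h | h
  · exact mul_nonpos_of_nonneg_of_nonpos (hy i) (cartanForm_coordVec_nonpos_of_eq_zero hx h)
  · simp [h]

lemma pFun_add (x y : V → ℤ) : pFun (x + y) = pFun x + pFun y - 1 - cartanForm x y := by
  simp only [pFun, eulerForm_add_left, eulerForm_add_right, cartanForm]; ring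

lemma two_mul_pFun (x : V → ℤ) : 2 * pFun x = 2 - cartanForm x x := by
  rw [cartanForm_self, pFun]; ring

lemma pFun_coordVec {v : V} (h : Loopfree v) : pFun (coordVec v) = 0 := by
  have := two_mul_pFun (coordVec v); rw [h.cartanForm_self] at this; omega

/-- This localises a pairing equal to -1 at a single vertex, and then at a single arrow. -/
lemma exists_of_sum_eq_one {ι : Type*} [Fintype ι] {f : ι → ℤ} (h0 : ∀ i, 0 ≤ f i)
    (h : ∑ i, f i = 1) : ∃ j, f j = 1 ∧ ∀ i, i ≠ j → f i = 0 := by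
  classical
  obtain ⟨j, _, hj⟩ : ∃ j ∈ Finset.univ, f j ≠ 0 :=
    Finset.exists_ne_zero_of_sum_ne_zero (by rw [h]; exact one_ne_zero)
  have h1 := Finset.add_sum_erase Finset.univ f (Finset.mem_univ j)
  have h2 := Finset.sum_nonneg fun i (_ : i ∈ Finset.univ.erase j) => h0 i
  have h3 := h0 j
  have h4 : ∑ i ∈ Finset.univ.erase j, f i = 0 := by omega
  refine ⟨j, by omega, fun i hi => ?_⟩
  exact (Finset.sum_eq_zero_iff_of_nonneg fun i _ => h0 i).mp h4 i (by simp [hi])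

lemma eq_one_of_mul_eq_one {a b : ℤ} (ha : 0 ≤ a) (h : a * b = 1) : a = 1 ∧ b = 1 := by
  rcases Int.mul_eq_one_iff_eq_one_or_neg_one.mp h with h | h
  · exact h
  · omega

/-! ### Reflections as isometries of the Cartan form. -/

section Reflections

lemma reflectVec_add (v : V) (x y : V → ℤ) :
    reflectVec v (x + y) = reflectVec v x + reflectVec v y := by
  simp only [reflectVec, cartanForm_add_left, add_smul]; abel

lemma reflectVec_neg (v : V) (x : V → ℤ) : reflectVec v (-x) = -reflectVec v x := by
  simp only [reflectVec, cartanForm_neg_left, neg_smul]; abel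

lemma reflectVec_smul (v : V) (n : ℤ) (x : V → ℤ) :
    reflectVec v (n • x) = n • reflectVec v x := by
  simp only [reflectVec, cartanForm_smul_left, mul_smul, smul_sub]

lemma reflectVec_of_eq_zero {v : V} {x : V → ℤ} (h : cartanForm x (coordVec v) = 0) :
    reflectVec v x = x := by simp [reflectVec, h]

lemma reflectVec_apply_of_ne {v i : V} (h : i ≠ v) (x : V → ℤ) : reflectVec v x i = x i := by
  simp [reflectVec, coordVec_of_ne h]

lemma reflectVec_apply_self (v : V) (x : V → ℤ) :
    reflectVec v x v = x v - cartanForm x (coordVec v) := by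
  simp [reflectVec, coordVec_self]

lemma sum_reflectVec (v : V) (x : V → ℤ) :
    ∑ i, reflectVec v x i = ∑ i, x i - cartanForm x (coordVec v) := by
  simp [reflectVec, coordVec, Finset.sum_sub_distrib, Pi.single_apply]

lemma cartanForm_reflectVec_left (v : V) (x y : V → ℤ) :
    cartanForm (reflectVec v x) y
      = cartanForm x y - cartanForm x (coordVec v) * cartanForm (coordVec v) y := by
  simp only [reflectVec, cartanForm_sub_left, cartanForm_smul_left]

lemma Loopfree.cartanForm_reflectVec_coordVec {v : V} (hv : Loopfree v) (x : V → ℤ) :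
    cartanForm (reflectVec v x) (coordVec v) = -cartanForm x (coordVec v) := by
  rw [cartanForm_reflectVec_left, hv.cartanForm_self]; ring

lemma Loopfree.reflectVec_reflectVec {v : V} (hv : Loopfree v) (x : V → ℤ) :
    reflectVec v (reflectVec v x) = x := by
  rw [reflectVec, hv.cartanForm_reflectVec_coordVec, reflectVec]; simp

lemma Loopfree.reflectVec_coordVec {v : V} (hv : Loopfree v) :
    reflectVec v (coordVec v) = -coordVec v := by
  rw [reflectVec, hv.cartanForm_self, two_smul]; abel

lemma Loopfree.cartanForm_reflectVec {v : V} (hv : Loopfree v) (x y : V → ℤ) :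
    cartanForm (reflectVec v x) (reflectVec v y) = cartanForm x y := by
  rw [cartanForm_reflectVec_left, cartanForm_comm x, cartanForm_comm _ (reflectVec v y),
    cartanForm_reflectVec_left, hv.cartanForm_reflectVec_coordVec, cartanForm_comm (coordVec v) x,
    cartanForm_comm x y]
  ring

lemma Loopfree.pFun_reflectVec {v : V} (hv : Loopfree v) (x : V → ℤ) :
    pFun (reflectVec v x) = pFun x := by
  have h1 := two_mul_pFun (reflectVec v x)
  have h2 := two_mul_pFun x
  rw [hv.cartanForm_reflectVec] at h1
  omega

end Reflections

/-! ### Connected supports. -/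

section Connected

lemma adj_iff {i j : V} :
    (underlyingGraph V).Adj i j ↔ i ≠ j ∧ cartanForm (coordVec i) (coordVec j) < 0 := by
  rw [underlyingGraph, SimpleGraph.fromRel_adj]
  refine and_congr_right fun h => ?_
  rw [cartanForm_coordVec_of_ne h, ← Fintype.card_pos_iff, ← Fintype.card_pos_iff]
  omega

/-- Connectedness in terms of cuts. -/
lemma connectedOn_iff {S : Set V} :
    ConnectedOn S ↔ S.Nonempty ∧ ∀ T ⊆ S, T.Nonempty →
      (∀ i ∈ T, ∀ j ∈ S, j ∉ T → cartanForm (coordVec i) (coordVec j) = 0) → S ⊆ T := by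
  constructor
  · intro h
    refine ⟨Set.nonempty_coe_sort.mp h.nonempty, fun T _ ⟨a, ha⟩ hT b hb => ?_⟩
    have haS : a ∈ S := by tauto
    obtain ⟨p⟩ := h.preconnected ⟨a, haS⟩ ⟨b, hb⟩
    have key : ∀ (x y : S), ((underlyingGraph V).induce S).Walk x y → x.1 ∈ T → y.1 ∈ T := by
      intro x y p
      induction p with
      | nil => exact id
      | @cons u v w huv _ ih =>
        intro hu
        apply ih
        by_contra hv
        have h1 := hT u.1 hu v.1 v.2 hv
        have h2 := (adj_iff.mp (SimpleGraph.comap_adj.mp huv)).2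
        simp only [Function.Embedding.subtype_apply] at h2
        omega
    exact key _ _ p ha
  · rintro ⟨⟨a, ha⟩, h⟩
    have : Nonempty S := ⟨⟨a, ha⟩⟩
    refine ⟨fun x y => ?_⟩
    -- The cut tested is the connected component of `x` in `S`, which no arrow within `S` leaves.
    have h1 := h {z | ∃ hz : z ∈ S, ((underlyingGraph V).induce S).Reachable x ⟨z, hz⟩}
      (fun z hz => hz.1) ⟨x.1, x.2, SimpleGraph.Reachable.refl _⟩ ?_ y.2
    · exact h1.2
    · rintro i ⟨hi, hxi⟩ j hj hj2
      by_contra hne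
      have hij : i ≠ j := by
        rintro rfl; exact hj2 ⟨hi, hxi⟩
      refine hj2 ⟨hj, hxi.trans (SimpleGraph.Adj.reachable ?_)⟩
      exact SimpleGraph.comap_adj.mpr
        (adj_iff.mpr ⟨hij, lt_of_le_of_ne (cartanForm_coordVec_nonpos hij) hne⟩)

lemma connectedOn_singleton (v : V) : ConnectedOn ({v} : Set V) := by
  rw [connectedOn_iff]
  refine ⟨⟨v, rfl⟩, fun T hT hn _ => ?_⟩
  rw [(Set.subset_singleton_iff_eq.mp hT).resolve_left hn.ne_empty]

/-- A union of two connected sets which are not separated from each other is connected. -/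
lemma ConnectedOn.union {S T : Set V} (hS : ConnectedOn S) (hT : ConnectedOn T)
    (h : ∃ i ∈ S, ∃ j ∈ T, i = j ∨ cartanForm (coordVec i) (coordVec j) ≠ 0) :
    ConnectedOn (S ∪ T) := by
  rw [connectedOn_iff] at *
  refine ⟨hS.1.mono Set.subset_union_left, fun U hUS hn hU => ?_⟩
  have hSU : (S ∩ U).Nonempty → S ⊆ U := fun hne =>
    (hS.2 (S ∩ U) Set.inter_subset_left hne fun i hi j hj hj2 =>
      hU i hi.2 j (Or.inl hj) fun h => hj2 ⟨hj, h⟩).trans Set.inter_subset_right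
  have hTU : (T ∩ U).Nonempty → T ⊆ U := fun hne =>
    (hT.2 (T ∩ U) Set.inter_subset_left hne fun i hi j hj hj2 =>
      hU i hi.2 j (Or.inr hj) fun h => hj2 ⟨hj, h⟩).trans Set.inter_subset_right
  obtain ⟨i, hi, j, hj, hij⟩ := h
  have h1 : i ∈ U → j ∈ U := fun hiU => by
    rcases hij with rfl | hij
    · exact hiU
    · by_contra hjU; exact hij (hU i hiU j (Or.inr hj) hjU)
  have h2 : j ∈ U → i ∈ U := fun hjU => by
    rcases hij with rfl | hij
    · exact hjU
    · by_contra hiU; exact hij (by rw [cartanForm_comm]; exact hU j hjU i (Or.inl hi) hiU)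
  obtain ⟨x, hx⟩ := hn
  rcases hUS hx with hxS | hxT
  · have hs := hSU ⟨x, hxS, hx⟩
    exact Set.union_subset hs (hTU ⟨j, hj, h1 (hs hi)⟩)
  · have ht := hTU ⟨x, hxT, hx⟩
    exact Set.union_subset (hSU ⟨i, hi, h2 (ht hj)⟩) ht

/-- Two vectors that are not orthogonal have supports which are not separated. -/
lemma exists_of_cartanForm_ne_zero {x y : V → ℤ} (h : cartanForm x y ≠ 0) :
    ∃ i ∈ Function.support x, ∃ j ∈ Function.support y,
      cartanForm (coordVec i) (coordVec j) ≠ 0 := by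
  rw [cartanForm_eq_sum] at h
  obtain ⟨j, _, hj⟩ := Finset.exists_ne_zero_of_sum_ne_zero h
  have h2 := right_ne_zero_of_mul hj
  rw [cartanForm_coordVec_eq_sum] at h2
  obtain ⟨i, _, hi⟩ := Finset.exists_ne_zero_of_sum_ne_zero h2
  exact ⟨i, left_ne_zero_of_mul hi, j, left_ne_zero_of_mul hj, right_ne_zero_of_mul hi⟩

lemma support_add_of_nonneg {x y : V → ℤ} (hx : 0 ≤ x) (hy : 0 ≤ y) :
    Function.support (x + y) = Function.support x ∪ Function.support y := by
  ext i
  have h1 := hx i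
  have h2 := hy i
  simp only [Pi.zero_apply] at h1 h2
  simp only [Function.mem_support, Pi.add_apply, Set.mem_union]
  omega

lemma support_coordVec (v : V) : Function.support (coordVec v : V → ℤ) = {v} := by
  ext i
  by_cases h : i = v
  · subst h; simp [coordVec_self]
  · simp [coordVec_of_ne h, h]

end Connected

/-! ### Positive roots as results of increasing reflections. -/

/-- The vectors that are reached from the fundamental region and the coordinate vectors at loopfree
vertices by reflections each of which increases an entry. These are the positive roots, see
`mem_positiveRoots_iff`. -/
inductive IncRoot : (V → ℤ) → Prop
  | fund {x : V → ℤ} : x ∈ fundamentalRegion V → IncRoot x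
  | coord {v : V} : Loopfree v → IncRoot (coordVec v)
  | up {v : V} {x : V → ℤ} : Loopfree v → IncRoot x → cartanForm x (coordVec v) < 0 →
      IncRoot (reflectVec v x)

lemma le_reflectVec {v : V} {x : V → ℤ} (h : cartanForm x (coordVec v) ≤ 0) :
    x ≤ reflectVec v x := by
  intro i
  by_cases hi : i = v
  · subst hi; rw [reflectVec_apply_self]; linarith
  · rw [reflectVec_apply_of_ne hi]

lemma IncRoot.nonneg {x : V → ℤ} (h : IncRoot x) : 0 ≤ x := by
  induction h with
  | fund h => exact h.1
  | coord _ => exact coordVec_nonneg _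
  | up _ _ h ih => exact ih.trans (le_reflectVec h.le)

lemma IncRoot.ne_zero {x : V → ℤ} (h : IncRoot x) : x ≠ 0 := by
  induction h with
  | fund h => exact h.2.1
  | coord _ => exact coordVec_ne_zero _
  | up _ hx h ih =>
    intro h0
    exact ih (le_antisymm ((le_reflectVec h.le).trans h0.le) hx.nonneg)

lemma sum_nonneg_of_nonneg {x : V → ℤ} (h : 0 ≤ x) : 0 ≤ ∑ i, x i :=
  Finset.sum_nonneg fun i _ => h i

/-- Transport of `IncRoot` along a reflection which decreases an entry. -/
lemma IncRoot.of_reflectVec {v : V} {x : V → ℤ} (hv : Loopfree v) (h : IncRoot (reflectVec v x))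
    (hx : 0 ≤ cartanForm x (coordVec v)) : IncRoot x := by
  rcases hx.lt_or_eq with hx | hx
  · have := IncRoot.up hv h (by rw [hv.cartanForm_reflectVec_coordVec]; omega)
    rwa [hv.reflectVec_reflectVec] at this
  · rwa [reflectVec_of_eq_zero hx.symm] at h

lemma reflectVec_comm {v w : V} (h : cartanForm (coordVec v) (coordVec w) = 0) (x : V → ℤ) :
    reflectVec v (reflectVec w x) = reflectVec w (reflectVec v x) := by
  have h' := h
  rw [cartanForm_comm] at h'
  simp only [reflectVec, cartanForm_sub_left, cartanForm_smul_left, h, h', mul_zero, sub_zero]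
  abel

/-- Two loopfree vertices joined by a single arrow span a root system of type A₂, so their
reflections satisfy the Coxeter relation of order three. -/
lemma reflectVec_braid {v w : V} (hv : Loopfree v) (hw : Loopfree w)
    (h : cartanForm (coordVec v) (coordVec w) = -1) (x : V → ℤ) :
    reflectVec v (reflectVec w (reflectVec v x)) = reflectVec w (reflectVec v (reflectVec w x)) := by
  have h' := h
  rw [cartanForm_comm] at h'
  simp only [reflectVec, cartanForm_sub_left, cartanForm_smul_left, h, h', hv.cartanForm_self,
    hw.cartanForm_self]
  module

/-- Alternating reflections at two vertices joined by at least two arrows decrease forever. -/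
lemma not_incRoot_of_cartanForm_lt {N : ℤ}
    (IH : ∀ x : V → ℤ, IncRoot x → ∑ i, x i < N → ∀ v, Loopfree v → x ≠ coordVec v →
      IncRoot (reflectVec v x)) (n : ℕ) {x : V → ℤ} (hx : IncRoot x) (hn : ∑ i, x i ≤ n)
    (hN : ∑ i, x i < N) {v w : V} (hv : Loopfree v) (hw : Loopfree w)
    (hvw : cartanForm (coordVec v) (coordVec w) ≤ -2) (h0 : 0 < cartanForm x (coordVec v))
    (h : -cartanForm x (coordVec w) < cartanForm x (coordVec v)) : False := by
  induction n generalizing x v w with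
  | zero =>
    refine hx.ne_zero (funext fun i => ?_)
    have h1 := sum_nonneg_of_nonneg hx.nonneg
    have h2 : ∑ i, x i = 0 := by push_cast at hn; omega
    exact (Finset.sum_eq_zero_iff_of_nonneg fun i _ => hx.nonneg i).mp h2 i (Finset.mem_univ i)
  | succ n ih =>
    have hne : x ≠ coordVec v := by
      rintro rfl
      rw [hv.cartanForm_self] at h
      omega
    have hs := sum_reflectVec v x
    have e1 := cartanForm_reflectVec_left v x (coordVec w)
    have e2 := hv.cartanForm_reflectVec_coordVec x
    -- The new pairing with e_w is at least (x, e_w) + 2(x, e_v), so positivity of (x, e_v) + (x,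
    -- e_w) survives with `v` and `w` exchanged. Each step lowers the height by (x, e_v) > 0.
    have key : cartanForm x (coordVec v) * cartanForm (coordVec v) (coordVec w)
        ≤ cartanForm x (coordVec v) * (-2) := mul_le_mul_of_nonneg_left hvw h0.le
    refine ih (IH x hx hN v hv hne) (by push_cast at hn; omega) (by omega) hw hv
      (by rwa [cartanForm_comm]) (by omega) (by omega)

/-- `IncRoot` is stable under the reflections at loopfree vertices `v`, except at `e_v`. -/
lemma IncRoot.reflectVec {x : V → ℤ} (hx : IncRoot x) {v : V} (hv : Loopfree v)
    (hne : x ≠ coordVec v) : IncRoot (reflectVec v x) := by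
  obtain ⟨n, hn⟩ : ∃ n : ℕ, ∑ i, x i < n := ⟨(∑ i, x i).toNat + 1, by omega⟩
  induction n generalizing x v with
  | zero =>
    have := sum_nonneg_of_nonneg hx.nonneg
    push_cast at hn; omega
  | succ n ih =>
    rcases lt_trichotomy (cartanForm x (coordVec v)) 0 with h | h | h
    · exact hx.up hv h
    · rwa [reflectVec_of_eq_zero h]
    · cases hx with
      | fund hx => exact absurd (hx.2.2.2 v) (not_le.mpr h)
      | @coord u hu =>
        have huv : u ≠ v := by rintro rfl; exact hne rfl
        exact absurd (cartanForm_coordVec_nonpos huv) (not_le.mpr h)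
      -- The root `x` arises from the lower root `y` by s_w. For w ≠ v, the relation between s_v and
      -- s_w lets s_v(x) be reached through roots lower than `x`, where the induction hypothesis
      -- applies.
      | @up w y hw hy hyw =>
        by_cases hvw : w = v
        · subst hvw; rwa [hw.reflectVec_reflectVec]
        have hx : IncRoot (MultQuiver.reflectVec w y) := hy.up hw hyw
        set x := MultQuiver.reflectVec w y with hxy
        have hyx : y = MultQuiver.reflectVec w x := by rw [hxy, hw.reflectVec_reflectVec]
        have hxw : cartanForm x (coordVec w) = -cartanForm y (coordVec w) :=
          hw.cartanForm_reflectVec_coordVec y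
        have hys : ∑ i, y i = ∑ i, x i - cartanForm x (coordVec w) := by
          rw [hyx, sum_reflectVec]
        have hyv : cartanForm y (coordVec v) = cartanForm x (coordVec v)
            - cartanForm x (coordVec w) * cartanForm (coordVec w) (coordVec v) := by
          rw [hyx, cartanForm_reflectVec_left]
        have hle := cartanForm_coordVec_nonpos (Ne.symm hvw)
        have hcomm := cartanForm_comm (coordVec w) (coordVec v)
        push_cast at hn
        have hyv0 : 0 < cartanForm y (coordVec v) := by
          rw [hyv, hcomm]; nlinarith
        obtain h0 | h1 | h2 : cartanForm (coordVec v) (coordVec w) = 0 ∨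
            cartanForm (coordVec v) (coordVec w) = -1 ∨
            cartanForm (coordVec v) (coordVec w) ≤ -2 := by omega
        · have hyne : y ≠ coordVec v := by
            intro hy2
            apply hne
            rw [hxy, hy2, reflectVec_of_eq_zero h0]
          have h3 := ih hy hv hyne (by omega)
          rw [hyx, reflectVec_comm h0] at h3
          refine h3.of_reflectVec hw ?_
          rw [cartanForm_reflectVec_left, h0]; omega
        · have hwv : cartanForm (coordVec w) (coordVec v) = -1 := by rw [hcomm, h1]
          by_cases hy2 : y = coordVec v
          · have : MultQuiver.reflectVec v x = coordVec w := by
              rw [hxy, hy2]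
              simp only [MultQuiver.reflectVec, cartanForm_sub_left, cartanForm_smul_left, h1, hwv,
                hv.cartanForm_self]
              module
            rw [this]; exact .coord hw
          · have h3 := ih hy hv hy2 (by omega)
            by_cases h4 : MultQuiver.reflectVec v y = coordVec w
            · exfalso
              apply hne
              have h5 : y = MultQuiver.reflectVec v (coordVec w) := by
                rw [← h4, hv.reflectVec_reflectVec]
              rw [hxy, h5]
              simp only [MultQuiver.reflectVec, cartanForm_sub_left, cartanForm_smul_left, h1, hwv,
                hw.cartanForm_self]
              module
            · have h6 := sum_reflectVec v y
              -- The braid relation turns s_w s_v(y) into s_v s_w s_v(x). Its two outer reflections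
              -- can be undone, since the pairings (x, e_w) and (x, e_v) + (x, e_w) are
              -- non-negative.
              have h5 := ih h3 hw h4 (by omega)
              rw [hyx, ← reflectVec_braid hv hw h1] at h5
              have h7 : cartanForm (MultQuiver.reflectVec v x) (coordVec w)
                  = cartanForm x (coordVec v) + cartanForm x (coordVec w) := by
                rw [cartanForm_reflectVec_left, h1]; ring
              have h8 : cartanForm (MultQuiver.reflectVec w (MultQuiver.reflectVec v x))
                  (coordVec v) = cartanForm x (coordVec w) := by
                rw [cartanForm_reflectVec_left, h7, hv.cartanForm_reflectVec_coordVec, hwv]; ring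
              exact (h5.of_reflectVec hv (by omega)).of_reflectVec hw (by omega)
        -- With at least two arrows between `v` and `w`, alternating reflections of `y` would lower
        -- the height for ever.
        · exfalso
          refine not_incRoot_of_cartanForm_lt (N := n) (fun z hz hzn u hu hzu => ih hz hu hzu hzn)
            (∑ i, y i).toNat hy ?_ ?_ hv hw h2 hyv0 ?_
          · have := sum_nonneg_of_nonneg hy.nonneg; omega
          · omega
          · rw [hyv, hcomm, ← hxw] at *
            nlinarith

lemma reflectVecList_cons (v : V) (vs : List V) (x : V → ℤ) :
    reflectVecList (v :: vs) x = reflectVecList vs (reflectVec v x) := rfl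

lemma reflectVecList_concat (v : V) (vs : List V) (x : V → ℤ) :
    reflectVecList (vs ++ [v]) x = reflectVec v (reflectVecList vs x) := by
  simp [reflectVecList]

lemma reflectVecList_smul (vs : List V) (n : ℤ) (x : V → ℤ) :
    reflectVecList vs (n • x) = n • reflectVecList vs x := by
  induction vs generalizing x with
  | nil => rfl
  | cons v vs ih => rw [reflectVecList_cons, reflectVec_smul, ih, reflectVecList_cons]

/-- A reflection s_v changes the sign of such a vector only at ±e_v. So every root is an `IncRoot`
up to sign, and non-negativity then decides the sign. -/
lemma pm_incRoot_reflectVecList {vs : List V} (hvs : ∀ v ∈ vs, Loopfree v) {x : V → ℤ}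
    (hx : IncRoot x ∨ IncRoot (-x)) :
    IncRoot (reflectVecList vs x) ∨ IncRoot (-reflectVecList vs x) := by
  induction vs generalizing x with
  | nil => exact hx
  | cons v vs ih =>
    rw [reflectVecList_cons]
    have hv := hvs v (by simp)
    refine ih (fun u hu => hvs u (by simp [hu])) ?_
    rcases hx with hx | hx
    · by_cases h : x = coordVec v
      · right; rw [h, hv.reflectVec_coordVec, neg_neg]; exact .coord hv
      · exact .inl (hx.reflectVec hv h)
    · by_cases h : -x = coordVec v
      · left
        rw [← neg_neg x, h, reflectVec_neg, hv.reflectVec_coordVec, neg_neg]; exact .coord hv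
      · right; rw [← reflectVec_neg]; exact hx.reflectVec hv h

lemma IncRoot.isRoot {x : V → ℤ} (hx : IncRoot x) : IsRealRoot x ∨ IsImaginaryRoot x := by
  induction hx with
  | @fund x h => exact .inr ⟨x, h, [], by simp, .inl rfl⟩
  | @coord v h => exact .inl ⟨v, [], h, by simp, rfl⟩
  | @up v x hv _ _ ih =>
    rcases ih with ⟨u, vs, hu, hvs, rfl⟩ | ⟨f, hf, vs, hvs, h⟩
    · refine .inl ⟨u, vs ++ [v], hu, ?_, (reflectVecList_concat _ _ _).symm⟩
      simpa [or_imp, forall_and] using ⟨hvs, hv⟩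
    · refine .inr ⟨f, hf, vs ++ [v], ?_, ?_⟩
      · simpa [or_imp, forall_and] using ⟨hvs, hv⟩
      · rw [reflectVecList_concat, reflectVecList_concat]
        exact h.imp (congrArg _) (congrArg _)

lemma mem_positiveRoots_iff {x : V → ℤ} : x ∈ positiveRoots V ↔ IncRoot x := by
  refine ⟨fun ⟨h0, h⟩ => ?_, fun h => ⟨h.nonneg, h.isRoot⟩⟩
  have : IncRoot x ∨ IncRoot (-x) := by
    rcases h with ⟨v, vs, hv, hvs, rfl⟩ | ⟨f, hf, vs, hvs, rfl | rfl⟩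
    · exact pm_incRoot_reflectVecList hvs (.inl (.coord hv))
    · exact pm_incRoot_reflectVecList hvs (.inl (.fund hf))
    · exact pm_incRoot_reflectVecList hvs (.inr (by rw [neg_neg]; exact .fund hf))
  refine this.resolve_right fun h => h.ne_zero (le_antisymm ?_ h.nonneg)
  simpa using h0

lemma IncRoot.connectedOn {x : V → ℤ} (hx : IncRoot x) : ConnectedOn (Function.support x) := by
  induction hx with
  | fund h => exact h.2.2.1
  | coord h => rw [support_coordVec]; exact connectedOn_singleton _
  | @up v x hv hx h ih =>
    have h1 : MultQuiver.reflectVec v x = x + (-cartanForm x (coordVec v)) • coordVec v := by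
      rw [MultQuiver.reflectVec]; module
    have h2 : Function.support ((-cartanForm x (coordVec v)) • coordVec v : V → ℤ) = {v} := by
      rw [← support_coordVec v]
      ext i
      simp [h.ne]
    rw [h1, support_add_of_nonneg hx.nonneg
      (smul_nonneg (by omega) (coordVec_nonneg v)), h2]
    refine ih.union (connectedOn_singleton v) ?_
    obtain ⟨i, hi, j, hj, hij⟩ := exists_of_cartanForm_ne_zero h.ne
    rw [support_coordVec] at hj
    exact ⟨i, hi, j, hj, .inr hij⟩

/-- The sum of two positive roots with negative pairing is a positive root. -/
lemma IncRoot.add {x y : V → ℤ} (hx : IncRoot x) (hy : IncRoot y) (h : cartanForm x y < 0) :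
    IncRoot (x + y) := by
  obtain ⟨n, hn⟩ : ∃ n : ℕ, ∑ i, (x + y) i < n := ⟨(∑ i, (x + y) i).toNat + 1, by omega⟩
  induction n generalizing x y with
  | zero =>
    have := sum_nonneg_of_nonneg (add_nonneg hx.nonneg hy.nonneg)
    push_cast at hn; omega
  | succ n ih =>
    have h0 := add_nonneg hx.nonneg hy.nonneg
    by_cases hF : ∀ i, cartanForm (x + y) (coordVec i) ≤ 0
    · refine .fund ⟨h0, fun h1 => hx.ne_zero (le_antisymm ?_ hx.nonneg), ?_, hF⟩
      · rw [← h1]; simpa using hy.nonneg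
      · rw [support_add_of_nonneg hx.nonneg hy.nonneg]
        refine hx.connectedOn.union hy.connectedOn ?_
        obtain ⟨i, hi, j, hj, hij⟩ := exists_of_cartanForm_ne_zero h.ne
        exact ⟨i, hi, j, hj, .inr hij⟩
    · push Not at hF
      obtain ⟨v, hv⟩ := hF
      have hl := loopfree_of_cartanForm_pos h0 hv
      have hv' := hv
      rw [cartanForm_add_left] at hv'
      -- Only the summand e_v is made negative by s_v. In that case the other summand pairs to -1
      -- with e_v, and the sum is its reflection.
      by_cases hxv : x = coordVec v
      · subst hxv
        rw [cartanForm_comm] at h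
        rw [hl.cartanForm_self] at hv'
        have h1 : cartanForm y (coordVec v) = -1 := by omega
        have := hy.up hl h
        rwa [MultQuiver.reflectVec, h1, neg_one_smul, sub_neg_eq_add, add_comm] at this
      by_cases hyv : y = coordVec v
      · subst hyv
        rw [hl.cartanForm_self] at hv'
        have h1 : cartanForm x (coordVec v) = -1 := by omega
        have := hx.up hl h
        rwa [MultQuiver.reflectVec, h1, neg_one_smul, sub_neg_eq_add] at this
      refine IncRoot.of_reflectVec hl ?_ hv.le
      rw [reflectVec_add]
      refine ih (hx.reflectVec hl hxv) (hy.reflectVec hl hyv) ?_ ?_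
      · rwa [hl.cartanForm_reflectVec]
      · rw [← reflectVec_add, sum_reflectVec]; push_cast at hn; omega

lemma fundamentalRegion.smul {x : V → ℤ} (hx : x ∈ fundamentalRegion V) {n : ℤ} (hn : 0 < n) :
    n • x ∈ fundamentalRegion V := by
  obtain ⟨h0, h1, h2, h3⟩ := hx
  refine ⟨smul_nonneg hn.le h0, smul_ne_zero hn.ne' h1, ?_, fun i => ?_⟩
  · convert h2 using 1
    ext i; simp [hn.ne']
  · rw [cartanForm_smul_left]
    exact mul_nonpos_of_nonneg_of_nonpos hn.le (h3 i)

lemma IsImaginaryRoot.smul {x : V → ℤ} (hx : IsImaginaryRoot x) {n : ℤ} (hn : 0 < n) :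
    IsImaginaryRoot (n • x) := by
  obtain ⟨f, hf, vs, hvs, h⟩ := hx
  refine ⟨n • f, fundamentalRegion.smul hf hn, vs, hvs, ?_⟩
  rw [← smul_neg, reflectVecList_smul, reflectVecList_smul]
  exact h.imp (congrArg _) (congrArg _)

lemma fundamentalRegion.cartanForm_nonpos {x y : V → ℤ} (hx : x ∈ fundamentalRegion V)
    (hy : 0 ≤ y) : cartanForm x y ≤ 0 := by
  rw [cartanForm_eq_sum]
  exact Finset.sum_nonpos fun i _ => mul_nonpos_of_nonneg_of_nonpos (hy i) (hx.2.2.2 i)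

lemma cartanForm_reflectVecList {vs : List V} (hvs : ∀ v ∈ vs, Loopfree v) (x y : V → ℤ) :
    cartanForm (reflectVecList vs x) (reflectVecList vs y) = cartanForm x y := by
  induction vs generalizing x y with
  | nil => rfl
  | cons v vs ih =>
    rw [reflectVecList_cons, reflectVecList_cons, ih fun u hu => hvs u (by simp [hu]),
      (hvs v (by simp)).cartanForm_reflectVec]

lemma IsImaginaryRoot.eulerForm_nonpos {x : V → ℤ} (hx : IsImaginaryRoot x) :
    eulerForm x x ≤ 0 := by
  obtain ⟨f, hf, vs, hvs, h⟩ := hx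
  have h1 := fundamentalRegion.cartanForm_nonpos hf hf.1
  have h2 : cartanForm x x = cartanForm f f := by
    rcases h with rfl | rfl
    · exact cartanForm_reflectVecList hvs f f
    · rw [cartanForm_reflectVecList hvs, cartanForm_neg_left, cartanForm_neg_right, neg_neg]
  rw [cartanForm_self] at h2
  omega

/-- A vector with connected support and an entry `1` at the only vertex where it may pair positively
is a root. -/
lemma incRoot_of_apply_eq_one {x : V → ℤ} (h0 : 0 ≤ x) (hc : ConnectedOn (Function.support x))
    {k : V} (hk : x k = 1) (h : ∀ i, i ≠ k → cartanForm x (coordVec i) ≤ 0) : IncRoot x := by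
  obtain ⟨n, hn⟩ : ∃ n : ℕ, ∑ i, x i < n := ⟨(∑ i, x i).toNat + 1, by omega⟩
  induction n generalizing x k with
  | zero =>
    have := sum_nonneg_of_nonneg h0
    push_cast at hn; omega
  | succ n ih =>
    by_cases hk0 : cartanForm x (coordVec k) ≤ 0
    · refine .fund ⟨h0, ?_, hc, fun i => ?_⟩
      · rintro rfl; simp at hk
      · by_cases hi : i = k
        · rwa [hi]
        · exact h i hi
    push Not at hk0
    have hl := loopfree_of_cartanForm_pos h0 hk0
    set y := x - coordVec k with hy
    have hxy : x = y + coordVec k := by rw [hy]; abel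
    have hy0 : 0 ≤ y := sub_nonneg.mpr (coordVec_le h0 (by omega))
    have hyk : y k = 0 := by simp [hy, hk, coordVec_self]
    have hyi : ∀ i, i ≠ k → y i = x i := fun i hi => by simp [hy, coordVec_of_ne hi]
    have hyp := cartanForm_coordVec_nonpos_of_eq_zero hy0 hyk
    have hxk : cartanForm x (coordVec k) = cartanForm y (coordVec k) + 2 := by
      rw [hxy, cartanForm_add_left, hl.cartanForm_self]
    have hsum : ∀ i, y i * cartanForm (coordVec i) (coordVec k) ≤ 0 := fun i => by
      by_cases hi : i = k
      · simp [hi, hyk]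
      · exact mul_nonpos_of_nonneg_of_nonpos (hy0 i) (cartanForm_coordVec_nonpos hi)
    have hyk2 := cartanForm_coordVec_eq_sum y k
    -- The positive number (x, e_k) = (y, e_k) + 2 leaves only two values of (y, e_k). The value 0
    -- isolates `k` in the support, so x = e_k.
    obtain hy2 | hy2 : ∑ i, y i * cartanForm (coordVec i) (coordVec k) = 0 ∨
        ∑ i, y i * cartanForm (coordVec i) (coordVec k) = -1 := by omega
    · have h1 := (Finset.sum_eq_zero_iff_of_nonpos fun i _ => hsum i).mp hy2
      have h2 : Function.support x ⊆ {k} := by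
        refine (connectedOn_iff.mp hc).2 {k} ?_ ⟨k, rfl⟩ ?_
        · rintro i rfl; simp [hk]
        · rintro i rfl j hj hji
          have := h1 j (Finset.mem_univ j)
          rw [hyi j hji] at this
          rw [cartanForm_comm]
          exact (mul_eq_zero.mp this).resolve_left hj
      have : x = coordVec k := by
        funext i
        by_cases hi : i = k
        · rw [hi, hk, coordVec_self]
        · rw [coordVec_of_ne hi]
          by_contra hxi
          exact hi (h2 hxi)
      rw [this]; exact .coord hl
    -- With the value -1, the vertex `k` is a leaf of the support, joined by a single arrow to a
    -- vertex `j` with y_j = 1, and s_k(x) = y. The induction continues with `j` in the role of `k`.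
    · obtain ⟨j, hj, hjk⟩ := exists_of_sum_eq_one
        (f := fun i => y i * -cartanForm (coordVec i) (coordVec k))
        (fun i => by have := hsum i; linarith)
        (by simp only [mul_neg, Finset.sum_neg_distrib]; omega)
      obtain ⟨hj1, hj2⟩ := eq_one_of_mul_eq_one (hy0 j) hj
      have hjk0 : j ≠ k := by rintro rfl; omega
      have hyx : y = MultQuiver.reflectVec k x := by
        rw [MultQuiver.reflectVec, hxk, hyk2, hy2, hy]; norm_num
      have hsupp : Function.support x = Function.support y ∪ {k} := by
        rw [hxy, support_add_of_nonneg hy0 (coordVec_nonneg k), support_coordVec]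
      have hkx : k ∈ Function.support x := by simp [hk]
      refine IncRoot.of_reflectVec hl ?_ hk0.le
      rw [← hyx]
      refine ih hy0 ?_ hj1 ?_ ?_
      · rw [connectedOn_iff]
        refine ⟨⟨j, by simp [hj1]⟩, fun T hT hTn hTc => ?_⟩
        have hnk : ∀ i ∈ Function.support y, i ≠ j →
            cartanForm (coordVec i) (coordVec k) = 0 := fun i hi hij => by
          have := hjk i hij
          simpa using (mul_eq_zero.mp this).resolve_left hi
        have hkT : k ∉ T := fun hkT => hT hkT hyk
        -- A cut of supp y that contains the neighbour `j` becomes a cut of supp x after adding the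
        -- leaf `k`; a cut without `j` already is one.
        by_cases hjT : j ∈ T
        · have := (connectedOn_iff.mp hc).2 (T ∪ {k}) ?_ (hTn.mono Set.subset_union_left) ?_
          · intro i hi
            rcases this (by rw [hsupp]; exact Or.inl hi) with h | h
            · exact h
            · exact absurd hyk (by rw [← Set.mem_singleton_iff.mp h]; exact hi)
          · rw [hsupp]; exact Set.union_subset_union_left _ hT
          · rintro i hi l hl hlT
            have hlk : l ≠ k := fun h => hlT (Or.inr h)
            have hly : l ∈ Function.support y := by rw [Function.mem_support, hyi l hlk]; exact hl
            rcases hi with hi | rfl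
            · exact hTc i hi l hly fun h => hlT (Or.inl h)
            · rw [cartanForm_comm]
              exact hnk l hly fun h => hlT (Or.inl (h ▸ hjT))
        · exfalso
          refine hkT ((connectedOn_iff.mp hc).2 T ?_ hTn ?_ hkx)
          · rw [hsupp]; exact hT.trans Set.subset_union_left
          · intro i hi l hl hlT
            by_cases hlk : l = k
            · subst hlk
              exact hnk i (hT hi) fun h => hjT (h ▸ hi)
            · exact hTc i hi l (by rw [Function.mem_support, hyi l hlk]; exact hl) hlT
      · intro i hij
        by_cases hyi0 : y i = 0
        · exact cartanForm_coordVec_nonpos_of_eq_zero hy0 hyi0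
        · have hik : i ≠ k := by rintro rfl; exact hyi0 hyk
          have h1 := h i hik
          have h2 : cartanForm (coordVec i) (coordVec k) = 0 := by
            simpa [hyi0] using hjk i hij
          rw [cartanForm_comm] at h2
          rwa [hxy, cartanForm_add_left, h2, add_zero] at h1
      · rw [hyx, sum_reflectVec]; push_cast at hn; omega

/-! ### Behaviour of N, R⁺, Σ and flatness under one reflection. -/

section Transfer

lemma qPow_add (q : V → ℂˣ) (x y : V → ℤ) : qPow q (x + y) = qPow q x * qPow q y := by
  simp [qPow, zpow_add, Finset.prod_mul_distrib]

lemma qPow_zsmul (q : V → ℂˣ) (n : ℤ) (x : V → ℤ) : qPow q (n • x) = qPow q x ^ n := by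
  simp only [qPow, Pi.smul_apply, smul_eq_mul, ← Finset.prod_zpow]
  exact Finset.prod_congr rfl fun i _ => by rw [mul_comm, zpow_mul]

lemma qPow_coordVec (q : V → ℂˣ) (v : V) : qPow q (coordVec v) = q v := by
  rw [qPow, Finset.prod_eq_single v]
  · simp [coordVec_self]
  · intro i _ hi; simp [coordVec_of_ne hi]
  · simp

lemma prod_zpow_eq_zpow_sum {ι G : Type*} [CommGroup G] (s : Finset ι) (a : G) (f : ι → ℤ) :
    ∏ i ∈ s, a ^ f i = a ^ ∑ i ∈ s, f i := by
  classical
  induction s using Finset.induction_on with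
  | empty => simp
  | insert i s hi ih => rw [Finset.prod_insert hi, Finset.sum_insert hi, zpow_add, ih]

/-- This and `sum_mul_reflectTheta` say that u_v and r_v are dual to s_v; hence the conditions
defining N_{q,θ} move along with reflections. -/
lemma qPow_reflectQ (q : V → ℂˣ) (v : V) (x : V → ℤ) :
    qPow (reflectQ v q) x = qPow q (reflectVec v x) := by
  have h1 : qPow (reflectQ v q) x = q v ^ (-cartanForm x (coordVec v)) * qPow q x := by
    simp only [qPow, reflectQ, mul_zpow, Finset.prod_mul_distrib]
    congr 1
    rw [cartanForm_comm, cartanForm_eq_sum, ← Finset.sum_neg_distrib]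
    rw [← prod_zpow_eq_zpow_sum]
    exact Finset.prod_congr rfl fun i _ => by rw [← zpow_mul]; congr 1; ring
  rw [h1, reflectVec, sub_eq_add_neg, ← neg_smul, qPow_add, qPow_zsmul, qPow_coordVec, mul_comm]

lemma sum_mul_reflectTheta (θ : V → ℤ) (v : V) (x : V → ℤ) :
    ∑ i, x i * reflectTheta v θ i = ∑ i, reflectVec v x i * θ i := by
  have h1 : ∑ i, (coordVec v : V → ℤ) i * θ i = θ v := by
    simp [coordVec, Pi.single_apply]
  have h2 : ∀ i, reflectVec v x i * θ i
      = x i * θ i - cartanForm x (coordVec v) * ((coordVec v : V → ℤ) i * θ i) := fun i => by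
    simp only [reflectVec, Pi.sub_apply, Pi.smul_apply, smul_eq_mul]; ring
  simp only [h2, Finset.sum_sub_distrib, ← Finset.mul_sum, h1]
  rw [cartanForm_comm x, cartanForm_eq_sum, Finset.sum_mul, ← Finset.sum_sub_distrib]
  exact Finset.sum_congr rfl fun i _ => by simp only [reflectTheta]; ring

lemma NSet.add {q : V → ℂˣ} {θ x y : V → ℤ} (hx : x ∈ NSet q θ) (hy : y ∈ NSet q θ) :
    x + y ∈ NSet q θ := by
  refine ⟨add_nonneg hx.1 hy.1, ?_, ?_⟩
  · rw [qPow_add, hx.2.1, hy.2.1, mul_one]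
  · simp only [Pi.add_apply, add_mul, Finset.sum_add_distrib, hx.2.2, hy.2.2, add_zero]

lemma NSet.of_add_left {q : V → ℂˣ} {θ x y : V → ℤ} (hx : x ∈ NSet q θ) (hxy : x + y ∈ NSet q θ)
    (hy : 0 ≤ y) : y ∈ NSet q θ := by
  refine ⟨hy, ?_, ?_⟩
  · have := hxy.2.1
    rwa [qPow_add, hx.2.1, one_mul] at this
  · have := hxy.2.2
    simp only [Pi.add_apply, add_mul, Finset.sum_add_distrib] at this
    rw [hx.2.2] at this
    omega

lemma NSet.smul {q : V → ℂˣ} {θ x : V → ℤ} (hx : x ∈ NSet q θ) {n : ℤ} (hn : 0 ≤ n) :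
    n • x ∈ NSet q θ := by
  refine ⟨smul_nonneg hn hx.1, by rw [qPow_zsmul, hx.2.1, one_zpow], ?_⟩
  simp only [Pi.smul_apply, smul_eq_mul, mul_assoc, ← Finset.mul_sum, hx.2.2, mul_zero]

lemma mem_RPlus_iff {q : V → ℂˣ} {θ x : V → ℤ} : x ∈ RPlus q θ ↔ IncRoot x ∧ x ∈ NSet q θ := by
  rw [RPlus, Set.mem_inter_iff, mem_positiveRoots_iff]

/-- The merging of roots in `R⁺_{q,θ}`. -/
lemma RPlus.add {q : V → ℂˣ} {θ x y : V → ℤ} (hx : x ∈ RPlus q θ) (hy : y ∈ RPlus q θ)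
    (h : cartanForm x y < 0) : x + y ∈ RPlus q θ := by
  rw [mem_RPlus_iff] at *
  exact ⟨hx.1.add hy.1 h, NSet.add hx.2 hy.2⟩

lemma mem_NSet_reflect {q : V → ℂˣ} {θ x : V → ℤ} {v : V} (h0 : 0 ≤ x)
    (h1 : 0 ≤ reflectVec v x) :
    x ∈ NSet (reflectQ v q) (reflectTheta v θ) ↔ reflectVec v x ∈ NSet q θ := by
  simp only [NSet, Set.mem_ofPred_eq, qPow_reflectQ, sum_mul_reflectTheta, h0, h1, true_and]

lemma reflectQ_reflectQ {v : V} (hv : Loopfree v) (q : V → ℂˣ) :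
    reflectQ v (reflectQ v q) = q := by
  funext i
  rw [← qPow_coordVec (reflectQ v (reflectQ v q)), qPow_reflectQ, qPow_reflectQ,
    hv.reflectVec_reflectVec, qPow_coordVec]

lemma reflectTheta_reflectTheta {v : V} (hv : Loopfree v) (θ : V → ℤ) :
    reflectTheta v (reflectTheta v θ) = θ := by
  funext i
  simp only [reflectTheta, hv.cartanForm_self]; ring

lemma coordVec_mem_NSet_iff {q : V → ℂˣ} {θ : V → ℤ} {v : V} :
    coordVec v ∈ NSet q θ ↔ q v = 1 ∧ θ v = 0 := by
  have h1 : ∑ i, (coordVec v : V → ℤ) i * θ i = θ v := by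
    simp [coordVec, Pi.single_apply]
  simp [NSet, qPow_coordVec, h1, coordVec_nonneg]

lemma coordVec_mem_NSet_reflect_iff {q : V → ℂˣ} {θ : V → ℤ} {v : V} (hv : Loopfree v) :
    coordVec v ∈ NSet (reflectQ v q) (reflectTheta v θ) ↔ coordVec v ∈ NSet q θ := by
  have h1 : reflectQ v q v = (q v)⁻¹ := by
    rw [reflectQ, hv.cartanForm_self, ← zpow_add_one]
    norm_num
  have h2 : reflectTheta v θ v = -θ v := by
    rw [reflectTheta, hv.cartanForm_self]; ring
  rw [coordVec_mem_NSet_iff, coordVec_mem_NSet_iff, h1, h2, inv_eq_one, neg_eq_zero]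

/-- The reflection at `v` maps `R⁺_{q,θ}` without `e_v` to the corresponding set of the reflected
parameters. -/
lemma reflectVec_mem_RPlus {q : V → ℂˣ} {θ x : V → ℤ} {v : V} (hv : Loopfree v)
    (hx : x ∈ RPlus q θ) (hne : x ≠ coordVec v) :
    reflectVec v x ∈ RPlus (reflectQ v q) (reflectTheta v θ) := by
  rw [mem_RPlus_iff] at *
  have h := hx.1.reflectVec hv hne
  refine ⟨h, ?_⟩
  rw [mem_NSet_reflect h.nonneg (by rw [hv.reflectVec_reflectVec]; exact hx.1.nonneg),
    hv.reflectVec_reflectVec]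
  exact hx.2

lemma reflectVec_list_sum (v : V) (l : List (V → ℤ)) :
    (l.map (reflectVec v)).sum = reflectVec v l.sum := by
  induction l with
  | nil => simp [reflectVec, cartanForm_zero_left]
  | cons a l ih => simp [ih, reflectVec_add]

lemma Loopfree.pFun_list_map {v : V} (hv : Loopfree v) (l : List (V → ℤ)) :
    (l.map (reflectVec v)).map pFun = l.map pFun := by
  simp [hv.pFun_reflectVec]

lemma ne_coordVec_of_mem_RPlus {q : V → ℂˣ} {θ x : V → ℤ} {v : V} (h : coordVec v ∉ NSet q θ)
    (hx : x ∈ RPlus q θ) : x ≠ coordVec v := by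
  rintro rfl; exact h (mem_RPlus_iff.mp hx).2

/-- As e_v lies in neither N-set, a decomposition can be reflected summand by summand with all
values of p kept. -/
lemma reflectVec_mem_SigmaSet {q : V → ℂˣ} {θ x : V → ℤ} {v : V} (hv : Loopfree v)
    (h : coordVec v ∉ NSet q θ) (hx : x ∈ SigmaSet q θ) :
    reflectVec v x ∈ SigmaSet (reflectQ v q) (reflectTheta v θ) := by
  refine ⟨reflectVec_mem_RPlus hv hx.1 (ne_coordVec_of_mem_RPlus h hx.1), fun l h2 hl hs => ?_⟩
  have h' : coordVec v ∉ NSet (reflectQ v q) (reflectTheta v θ) := by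
    rwa [coordVec_mem_NSet_reflect_iff hv]
  have := hx.2 (l.map (reflectVec v)) (by simpa using h2) ?_ ?_
  · rwa [hv.pFun_list_map, ← hv.pFun_reflectVec] at this
  · intro β hβ
    obtain ⟨γ, hγ, rfl⟩ := List.mem_map.mp hβ
    have := reflectVec_mem_RPlus hv (hl γ hγ) (ne_coordVec_of_mem_RPlus h' (hl γ hγ))
    rwa [reflectQ_reflectQ hv, reflectTheta_reflectTheta hv] at this
  · rw [reflectVec_list_sum, hs, hv.reflectVec_reflectVec]

lemma reflectVec_mem_FlatSet {q : V → ℂˣ} {θ x : V → ℤ} {v : V} (hv : Loopfree v)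
    (h : coordVec v ∉ NSet q θ) (h0 : 0 ≤ reflectVec v x) (hx : x ∈ FlatSet q θ) :
    reflectVec v x ∈ FlatSet (reflectQ v q) (reflectTheta v θ) := by
  refine ⟨?_, fun l hl hs => ?_⟩
  · rw [mem_NSet_reflect h0 (by rw [hv.reflectVec_reflectVec]; exact hx.1.1),
      hv.reflectVec_reflectVec]
    exact hx.1
  have h' : coordVec v ∉ NSet (reflectQ v q) (reflectTheta v θ) := by
    rwa [coordVec_mem_NSet_reflect_iff hv]
  have := hx.2 (l.map (reflectVec v)) ?_ ?_
  · rwa [hv.pFun_list_map, ← hv.pFun_reflectVec] at this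
  · intro β hβ
    obtain ⟨γ, hγ, rfl⟩ := List.mem_map.mp hβ
    have := reflectVec_mem_RPlus hv (hl γ hγ) (ne_coordVec_of_mem_RPlus h' (hl γ hγ))
    rwa [reflectQ_reflectQ hv, reflectTheta_reflectTheta hv] at this
  · rw [reflectVec_list_sum, hs, hv.reflectVec_reflectVec]

lemma mem_SigmaSet_reflect_iff {q : V → ℂˣ} {θ x : V → ℤ} {v : V} (hv : Loopfree v)
    (h : coordVec v ∉ NSet q θ) :
    reflectVec v x ∈ SigmaSet (reflectQ v q) (reflectTheta v θ) ↔ x ∈ SigmaSet q θ := by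
  refine ⟨fun hx => ?_, reflectVec_mem_SigmaSet hv h⟩
  have := reflectVec_mem_SigmaSet hv (by rwa [coordVec_mem_NSet_reflect_iff hv]) hx
  rwa [reflectQ_reflectQ hv, reflectTheta_reflectTheta hv, hv.reflectVec_reflectVec] at this

lemma mem_FlatSet_reflect_iff {q : V → ℂˣ} {θ x : V → ℤ} {v : V} (hv : Loopfree v)
    (h : coordVec v ∉ NSet q θ) (h0 : 0 ≤ x) (h1 : 0 ≤ reflectVec v x) :
    reflectVec v x ∈ FlatSet (reflectQ v q) (reflectTheta v θ) ↔ x ∈ FlatSet q θ := by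
  refine ⟨fun hx => ?_, reflectVec_mem_FlatSet hv h h1⟩
  have := reflectVec_mem_FlatSet hv (by rwa [coordVec_mem_NSet_reflect_iff hv])
    (by rwa [hv.reflectVec_reflectVec]) hx
  rwa [reflectQ_reflectQ hv, reflectTheta_reflectTheta hv, hv.reflectVec_reflectVec] at this

lemma reflectQ_of_eq_one {q : V → ℂˣ} {v : V} (h : q v = 1) : reflectQ v q = q := by
  funext i; simp [reflectQ, h]

lemma reflectTheta_of_eq_zero {θ : V → ℤ} {v : V} (h : θ v = 0) : reflectTheta v θ = θ := by
  funext i; simp [reflectTheta, h]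

lemma list_sum_pFun_replicate_coordVec {v : V} (hv : Loopfree v) (n : ℕ) :
    ((List.replicate n (coordVec v : V → ℤ)).map pFun).sum = 0 := by
  simp [pFun_coordVec hv]

/-- If `e_v ∈ R⁺_{q,θ}` and the reflection at `v` decreases `α`, then `α` is not in `Σ_{q,θ}`. -/
lemma notMem_SigmaSet_of_coordVec_mem {q : V → ℂˣ} {θ x : V → ℤ} {v : V} (hv : Loopfree v)
    (h : coordVec v ∈ RPlus q θ) (h1 : reflectVec v x ∈ RPlus q θ)
    (h2 : 0 < cartanForm x (coordVec v)) : x ∉ SigmaSet q θ := by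
  intro hx
  -- The (x, e_v) copies of e_v contribute nothing to the total p, and p(s_v(x)) = p(x), so the
  -- strict inequality fails.
  have := hx.2 (reflectVec v x :: List.replicate (cartanForm x (coordVec v)).toNat (coordVec v))
    (by simp; omega) ?_ ?_
  · rw [List.map_cons, List.sum_cons, list_sum_pFun_replicate_coordVec hv,
      hv.pFun_reflectVec] at this
    omega
  · intro β hβ
    rcases List.mem_cons.mp hβ with rfl | hβ
    · exact h1
    · rwa [List.eq_of_mem_replicate hβ]
  · rw [List.sum_cons, List.sum_replicate, ← natCast_zsmul, Int.toNat_of_nonneg h2.le, reflectVec]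
    abel

/-- If `e_v ∈ R⁺_{q,θ}` and the reflection at `v` decreases `α` by at least `2`, then `α` is not
flat. -/
lemma notMem_FlatSet_of_coordVec_mem {q : V → ℂˣ} {θ x : V → ℤ} {v : V} (hv : Loopfree v)
    (h : coordVec v ∈ RPlus q θ) (h1 : reflectVec v x ∈ RPlus q θ)
    (h2 : 2 ≤ cartanForm x (coordVec v)) : x ∉ FlatSet q θ := by
  intro hx
  have h3 := hv.cartanForm_reflectVec_coordVec x
  have h4 := RPlus.add h1 h (by omega)
  -- Absorbing one e_v into s_v(x) raises p by (x, e_v) - 1 ≥ 1.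
  have := hx.2 ((reflectVec v x + coordVec v) ::
    List.replicate (cartanForm x (coordVec v) - 1).toNat (coordVec v)) ?_ ?_
  · rw [List.map_cons, List.sum_cons, list_sum_pFun_replicate_coordVec hv, pFun_add,
      hv.pFun_reflectVec, pFun_coordVec hv, h3] at this
    omega
  · intro β hβ
    rcases List.mem_cons.mp hβ with rfl | hβ
    · exact h4
    · rwa [List.eq_of_mem_replicate hβ]
  · rw [List.sum_cons, List.sum_replicate, ← natCast_zsmul, Int.toNat_of_nonneg (by omega),
      reflectVec]
    module

/-- If `e_v ∈ R⁺_{q,θ}`, then a `(-1)`-reflection at `v` preserves flatness. -/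
lemma mem_FlatSet_reflect_iff_of_coordVec_mem {q : V → ℂˣ} {θ x : V → ℤ} {v : V}
    (hv : Loopfree v) (h : coordVec v ∈ RPlus q θ) (h0 : 0 ≤ reflectVec v x)
    (h2 : cartanForm x (coordVec v) = 1) :
    reflectVec v x ∈ FlatSet q θ ↔ x ∈ FlatSet q θ := by
  have hs : reflectVec v x + coordVec v = x := by rw [reflectVec, h2, one_smul]; abel
  have hp := hv.pFun_reflectVec x
  have hc := (mem_RPlus_iff.mp h).2
  obtain ⟨hq, hθ⟩ := coordVec_mem_NSet_iff.mp hc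
  constructor
  · intro hx
    refine ⟨by rw [← hs]; exact NSet.add hx.1 hc, fun l hl hsum => ?_⟩
    -- If e_v is a summand, dropping one copy decomposes s_v(x). If not, every summand can be
    -- reflected, and the parameters are fixed by the reflection because q_v = 1 and θ_v = 0.
    by_cases hmem : coordVec v ∈ l
    · have h3 := List.perm_cons_erase hmem
      have h4 := (h3.map pFun).sum_eq
      have h5 := h3.sum_eq
      rw [List.map_cons, List.sum_cons, pFun_coordVec hv, zero_add] at h4
      rw [List.sum_cons, hsum] at h5
      rw [h4, ← hp]
      refine hx.2 _ (fun β hβ => hl β (List.mem_of_mem_erase hβ)) ?_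
      rw [← hs] at h5
      have : reflectVec v x + coordVec v - coordVec v = reflectVec v x := by abel
      rw [← this, h5]; abel
    · rw [← hp, ← hv.pFun_list_map]
      refine hx.2 _ ?_ (by rw [reflectVec_list_sum, hsum])
      intro β hβ
      obtain ⟨γ, hγ, rfl⟩ := List.mem_map.mp hβ
      have := reflectVec_mem_RPlus hv (hl γ hγ) (by rintro rfl; exact hmem hγ)
      rwa [reflectQ_of_eq_one hq, reflectTheta_of_eq_zero hθ] at this
  · intro hx
    refine ⟨NSet.of_add_left hc (by rw [add_comm, hs]; exact hx.1) h0, fun l hl hsum => ?_⟩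
    have := hx.2 (coordVec v :: l) ?_ ?_
    · rw [List.map_cons, List.sum_cons, pFun_coordVec hv, zero_add] at this
      rwa [hp]
    · intro β hβ
      rcases List.mem_cons.mp hβ with rfl | hβ
      · exact h
      · exact hl β hβ
    · rw [List.sum_cons, hsum, add_comm, hs]

end Transfer

/-! ### Reflecting sequences. -/

section Sequences

lemma Triple.isReflectingSequence_cons (t : Triple V) (v : V) (vs : List V) :
    t.IsReflectingSequence (v :: vs) ↔
      Loopfree v ∧ (t.reflect v).α v < t.α v ∧ (t.reflect v).IsReflectingSequence vs := by
  have h1 : ∀ i, t.after (v :: vs) (i + 1) = (t.reflect v).after vs i := fun i => rfl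
  have h2 : t.final (v :: vs) = (t.reflect v).final vs := rfl
  simp only [Triple.IsReflectingSequence, h1, h2, List.mem_cons, forall_eq_or_imp]
  constructor
  · rintro ⟨⟨h3, h4⟩, h5, h6⟩
    exact ⟨h3, h6 ⟨0, by simp⟩, h4, h5, fun i => h6 i.succ⟩
  · rintro ⟨h3, h7, h4, h5, h6⟩
    refine ⟨⟨h3, h4⟩, h5, fun i => ?_⟩
    refine Fin.cases ?_ (fun i => ?_) i
    · exact h7
    · exact h6 i

lemma Triple.isReflectingSequence_nil (t : Triple V) :
    t.IsReflectingSequence [] ↔ t.α ∈ fundamentalRegion V ∨ ∃ v, t.α = coordVec v := by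
  simp [Triple.IsReflectingSequence, Triple.final, Triple.after]

lemma Triple.IsReflectingSequence.nonneg {t : Triple V} {vs : List V}
    (h : t.IsReflectingSequence vs) : 0 ≤ t.α := by
  induction vs generalizing t with
  | nil =>
    rcases t.isReflectingSequence_nil.mp h with h | ⟨v, h⟩
    · exact h.1
    · rw [h]; exact coordVec_nonneg v
  | cons v vs ih =>
    obtain ⟨_, h2, h3⟩ := (t.isReflectingSequence_cons v vs).mp h
    refine (ih h3).trans fun i => ?_
    by_cases hi : i = v
    · rw [hi]; exact h2.le
    · exact (reflectVec_apply_of_ne hi t.α).le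

/-- Undoing the increasing reflections that build `x`, last one first, lowers an entry each time. -/
lemma IncRoot.exists_isReflectingSequence {x : V → ℤ} (hx : IncRoot x) (q : V → ℂˣ) (θ : V → ℤ) :
    ∃ vs : List V, (Triple.mk q θ x).IsReflectingSequence vs := by
  induction hx generalizing q θ with
  | fund h => exact ⟨[], (Triple.isReflectingSequence_nil _).mpr (.inl h)⟩
  | @coord v _ => exact ⟨[], (Triple.isReflectingSequence_nil _).mpr (.inr ⟨v, rfl⟩)⟩
  | @up v x hv _ h ih =>
    obtain ⟨vs, hvs⟩ := ih (reflectQ v q) (reflectTheta v θ)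
    refine ⟨v :: vs, (Triple.isReflectingSequence_cons _ _ _).mpr ⟨hv, ?_, ?_⟩⟩
    · simp only [Triple.reflect, hv.reflectVec_reflectVec, reflectVec_apply_self]
      omega
    · simpa only [Triple.reflect, hv.reflectVec_reflectVec] using hvs

/-- The behaviour of membership in `Σ` and of flatness along a reflecting sequence. -/
lemma notMem_iff_of_isReflectingSequence (vs : List V) (t : Triple V)
    (ht : t.IsReflectingSequence vs) (hα : t.α ∈ RPlus t.q t.θ) :
    (t.final vs).α ∈ RPlus (t.final vs).q (t.final vs).θ ∧
    (t.α ∉ SigmaSet t.q t.θ ↔ (∃ i : Fin vs.length, ¬ (t.after vs i).Admissible vs[i]) ∨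
      (t.final vs).α ∉ SigmaSet (t.final vs).q (t.final vs).θ) ∧
    (t.α ∉ FlatSet t.q t.θ ↔ (∃ i : Fin vs.length, ¬ (t.after vs i).Admissible vs[i] ∧
        ¬ (t.after vs i).MinusOne vs[i]) ∨
      (t.final vs).α ∉ FlatSet (t.final vs).q (t.final vs).θ) := by
  induction vs generalizing t with
  | nil =>
    refine ⟨hα, ⟨.inr, fun h => h.resolve_left ?_⟩, ⟨.inr, fun h => h.resolve_left ?_⟩⟩
    · rintro ⟨i, _⟩; exact i.elim0
    · rintro ⟨i, _⟩; exact i.elim0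
  | cons v vs ih =>
    obtain ⟨hv, h2, h3⟩ := (t.isReflectingSequence_cons v vs).mp ht
    have h0 : 0 ≤ reflectVec v t.α := h3.nonneg
    -- The vector after the reflection still starts a reflecting sequence and is therefore
    -- non-negative, unlike s_v(e_v) = -e_v.
    have hne : t.α ≠ coordVec v := by
      intro h
      have := h0 v
      rw [h, hv.reflectVec_coordVec, Pi.neg_apply, coordVec_self, Pi.zero_apply] at this
      norm_num at this
    have hr : reflectVec v t.α ∈ RPlus (reflectQ v t.q) (reflectTheta v t.θ) :=
      reflectVec_mem_RPlus hv hα hne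
    have hpos : 0 < cartanForm t.α (coordVec v) := by
      have : reflectVec v t.α v < t.α v := h2
      rw [reflectVec_apply_self] at this
      omega
    obtain ⟨ih1, ih2, ih3⟩ := ih (t.reflect v) h3 hr
    have e1 : (t.reflect v).α = reflectVec v t.α := rfl
    have e2 : (t.reflect v).q = reflectQ v t.q := rfl
    have e3 : (t.reflect v).θ = reflectTheta v t.θ := rfl
    have hadm : t.Admissible v ↔ coordVec v ∉ NSet t.q t.θ := by
      rw [coordVec_mem_NSet_iff, Triple.Admissible]; tauto
    have hnadm : ¬ t.Admissible v → coordVec v ∈ NSet t.q t.θ := fun ha =>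
      by_contra fun h => ha (hadm.mpr h)
    have hex : ∀ P : Triple V → V → Prop,
        (∃ i : Fin (v :: vs).length, P (t.after (v :: vs) i) (v :: vs)[i]) ↔
        P t v ∨ ∃ i : Fin vs.length, P ((t.reflect v).after vs i) vs[i] := fun P =>
      Fin.exists_fin_succ
    have h4 : t.final (v :: vs) = (t.reflect v).final vs := rfl
    rw [hex fun t v => ¬ t.Admissible v, hex fun t v => ¬ t.Admissible v ∧ ¬ t.MinusOne v, h4]
    refine ⟨ih1, ?_, ?_⟩
    · rw [or_assoc, ← ih2, e1, e2, e3]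
      by_cases ha : t.Admissible v
      · simp [mem_SigmaSet_reflect_iff hv (hadm.mp ha), ha]
      · have hc : coordVec v ∈ NSet t.q t.θ := hnadm ha
        obtain ⟨hq, hθ⟩ := coordVec_mem_NSet_iff.mp hc
        rw [reflectQ_of_eq_one hq, reflectTheta_of_eq_zero hθ] at hr
        have := notMem_SigmaSet_of_coordVec_mem hv (mem_RPlus_iff.mpr ⟨.coord hv, hc⟩) hr hpos
        simp [this, ha]
    · rw [or_assoc, ← ih3, e1, e2, e3]
      by_cases ha : t.Admissible v
      · rw [mem_FlatSet_reflect_iff hv (hadm.mp ha) ht.nonneg h0]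
        simp [ha]
      · have hc : coordVec v ∈ NSet t.q t.θ := hnadm ha
        obtain ⟨hq, hθ⟩ := coordVec_mem_NSet_iff.mp hc
        rw [reflectQ_of_eq_one hq, reflectTheta_of_eq_zero hθ] at hr ⊢
        have hcr : coordVec v ∈ RPlus t.q t.θ := mem_RPlus_iff.mpr ⟨.coord hv, hc⟩
        have hm : t.MinusOne v ↔ cartanForm t.α (coordVec v) = 1 := by
          rw [Triple.MinusOne]
          constructor
          · intro h
            have := congrFun h v
            rw [reflectVec_apply_self, Pi.sub_apply, coordVec_self] at this
            omega
          · intro h; rw [reflectVec, h, one_smul]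
        by_cases h1 : cartanForm t.α (coordVec v) = 1
        · rw [mem_FlatSet_reflect_iff_of_coordVec_mem hv hcr h0 h1]
          simp [hm, h1]
        · have := notMem_FlatSet_of_coordVec_mem hv hcr hr (by omega)
          simp [this, ha, hm, h1]

end Sequences

/-! ### Kac's inequality for (y, α - y). -/

section Kac

/-- The left side is the sum of (e_i, e_j) α_i α_j x_i(1 - x_j). Symmetrised in i and j, the factor
x_i(1 - x_j) equals half of x_i(1 - x_i) + x_j(1 - x_j) + (x_i - x_j)². -/
lemma kac_identity (α y : V → ℤ) (x : V → ℚ) (hx : ∀ i, (y i : ℚ) = x i * α i) :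
    (cartanForm y (α - y) : ℚ) = ∑ i, x i * (1 - x i) * α i * cartanForm α (coordVec i)
      + ∑ i, ∑ j, cartanForm (coordVec i) (coordVec j) * α i * α j * (x i - x j) ^ 2 / 2 := by
  set a : V → V → ℚ := fun i j => (cartanForm (coordVec i) (coordVec j) : ℤ) with ha
  have hsymm : ∀ i j, a i j = a j i := fun i j => by simp only [ha, cartanForm_comm]
  have h1 : (cartanForm y (α - y) : ℚ)
      = ∑ i, ∑ j, a i j * α i * α j * (x i * (1 - x j)) := by
    rw [cartanForm_eq_sum]
    simp only [cartanForm_coordVec_eq_sum y]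
    push_cast
    rw [Finset.sum_comm' (t' := Finset.univ) (s' := fun _ => Finset.univ) (by simp)]
    refine Finset.sum_congr rfl fun j _ => ?_
    rw [Finset.mul_sum]
    refine Finset.sum_congr rfl fun i _ => ?_
    simp only [Pi.sub_apply]
    push_cast
    rw [hx i, hx j]
    ring
  have h2 : ∀ i, x i * (1 - x i) * α i * (cartanForm α (coordVec i) : ℤ)
      = ∑ j, a i j * α i * α j * (x i * (1 - x i)) := fun i => by
    rw [cartanForm_coordVec_eq_sum]
    push_cast
    rw [Finset.mul_sum]
    refine Finset.sum_congr rfl fun j _ => ?_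
    rw [hsymm i j]
    simp only [ha]; ring
  have h3 : ∑ i, ∑ j, a i j * α i * α j * (x i ^ 2 / 2)
      = ∑ i, ∑ j, a i j * α i * α j * (x j ^ 2 / 2) := by
    rw [Finset.sum_comm]
    refine Finset.sum_congr rfl fun j _ => Finset.sum_congr rfl fun i _ => ?_
    rw [hsymm i j]; ring
  rw [h1]
  simp only [h2]
  rw [← Finset.sum_add_distrib, ← sub_eq_zero, ← Finset.sum_sub_distrib,
    ← sub_eq_zero.mpr h3, ← Finset.sum_sub_distrib]
  refine Finset.sum_congr rfl fun i _ => ?_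
  rw [← Finset.sum_add_distrib, ← Finset.sum_sub_distrib, ← Finset.sum_sub_distrib]
  refine Finset.sum_congr rfl fun j _ => ?_
  ring

/-- Kac's inequality, with the case of equality. -/
lemma kac_inequality {α y : V → ℤ} (h0 : 0 ≤ α) (hc : ConnectedOn (Function.support α))
    (hy : ∀ i, α i = 0 → y i = 0)
    (hF : ∀ i, y i * (α i - y i) * cartanForm α (coordVec i) ≤ 0) :
    cartanForm y (α - y) ≤ 0 ∧ (cartanForm y (α - y) = 0 →
      (∀ i j, y i * α j = y j * α i) ∧
        ∀ i, y i * (α i - y i) * cartanForm α (coordVec i) = 0) := by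
  -- Where α_i = 0 the quotient is 0 by convention, in agreement with y_i = 0.
  set x : V → ℚ := fun i => y i / α i with hxdef
  have hx : ∀ i, (y i : ℚ) = x i * α i := fun i => by
    by_cases h : α i = 0
    · simp [hxdef, h, hy i h]
    · have : (α i : ℚ) ≠ 0 := by exact_mod_cast h
      simp only [hxdef]; field_simp
  have hid := kac_identity α y x hx
  have hα : ∀ i, (0 : ℚ) ≤ α i := fun i => by exact_mod_cast h0 i
  have hterm : ∀ i, α i * (x i * (1 - x i) * α i * (cartanForm α (coordVec i) : ℤ))
      = ((y i * (α i - y i) * cartanForm α (coordVec i) : ℤ) : ℚ) := fun i => by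
    push_cast; rw [hx i]; ring
  have h1 : ∀ i, x i * (1 - x i) * α i * (cartanForm α (coordVec i) : ℤ) ≤ 0 := fun i => by
    rcases (hα i).lt_or_eq with h | h
    · have h2 : ((y i * (α i - y i) * cartanForm α (coordVec i) : ℤ) : ℚ) ≤ 0 := by
        exact_mod_cast hF i
      rw [← hterm] at h2
      by_contra h3
      exact absurd h2 (not_le.mpr (mul_pos h (not_le.mp h3)))
    · rw [← h]; simp
  have h2 : ∀ i j, (cartanForm (coordVec i) (coordVec j) : ℚ) * α i * α j * (x i - x j) ^ 2 / 2
      ≤ 0 := fun i j => by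
    by_cases hij : i = j
    · simp [hij]
    · have h3 : (cartanForm (coordVec i) (coordVec j) : ℚ) ≤ 0 := by
        exact_mod_cast cartanForm_coordVec_nonpos hij
      have h4 : 0 ≤ (α i : ℚ) * α j * (x i - x j) ^ 2 / 2 := by
        have := hα i; have := hα j; positivity
      calc _ = (cartanForm (coordVec i) (coordVec j) : ℚ) * (α i * α j * (x i - x j) ^ 2 / 2) := by
            ring
        _ ≤ 0 := mul_nonpos_of_nonpos_of_nonneg h3 h4
  have s1 := Finset.sum_nonpos fun i (_ : i ∈ Finset.univ) => h1 i
  have s2 := Finset.sum_nonpos fun i (_ : i ∈ Finset.univ) =>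
    Finset.sum_nonpos fun j (_ : j ∈ Finset.univ) => h2 i j
  refine ⟨by have : (cartanForm y (α - y) : ℚ) ≤ 0 := by linarith
             exact_mod_cast this, fun heq => ?_⟩
  rw [heq, Int.cast_zero] at hid
  have e1 := (Finset.sum_eq_zero_iff_of_nonpos fun i _ => h1 i).mp (by linarith)
  have e2 := (Finset.sum_eq_zero_iff_of_nonpos fun i (_ : i ∈ Finset.univ) =>
    Finset.sum_nonpos fun j (_ : j ∈ Finset.univ) => h2 i j).mp (by linarith)
  have e3 : ∀ i j, (cartanForm (coordVec i) (coordVec j) : ℚ) * α i * α j * (x i - x j) ^ 2 / 2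
      = 0 := fun i j =>
    (Finset.sum_eq_zero_iff_of_nonpos fun j _ => h2 i j).mp (e2 i (Finset.mem_univ i)) j
      (Finset.mem_univ j)
  constructor
  · intro i j
    by_cases hi : α i = 0
    · rw [hi, hy i hi]; ring
    by_cases hj : α j = 0
    · rw [hj, hy j hj]; ring
    -- Equality makes all squares (x_k - x_l)² along arrows in the support vanish, so the level set
    -- of `x` through `i` is a cut and exhausts the support.
    have h3 := (connectedOn_iff.mp hc).2 {k | k ∈ Function.support α ∧ x k = x i}
      (fun k hk => hk.1) ⟨i, hi, rfl⟩ ?_ hj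
    · have : (y i * α j : ℚ) = y j * α i := by rw [hx i, hx j, h3.2]; ring
      exact_mod_cast this
    · rintro k ⟨hk, hki⟩ l hl hlk
      have h4 : x k ≠ x l := fun h => hlk ⟨hl, by rw [← h, hki]⟩
      have h5 := e3 k l
      have hk' : (α k : ℚ) ≠ 0 := by exact_mod_cast hk
      have hl' : (α l : ℚ) ≠ 0 := by exact_mod_cast hl
      have h6 := pow_ne_zero 2 (sub_ne_zero.mpr h4)
      simpa [hk', hl', h6, sub_ne_zero.mpr h4] using h5
  · intro i
    have := hterm i
    rw [e1 i (Finset.mem_univ i), mul_zero] at this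
    exact_mod_cast this.symm

/-- The form on the support of a connected vector in the radical is positive semidefinite. -/
lemma cartanForm_self_nonneg_of_radical {δ x : V → ℤ} (h0 : 0 ≤ δ)
    (hc : ConnectedOn (Function.support δ))
    (hr : ∀ i, δ i ≠ 0 → cartanForm δ (coordVec i) = 0) (hx : ∀ i, δ i = 0 → x i = 0) :
    0 ≤ cartanForm x x ∧ (cartanForm x x = 0 → ∀ i j, x i * δ j = x j * δ i) := by
  have h1 : cartanForm x δ = 0 := by
    rw [cartanForm_comm, cartanForm_eq_sum]
    refine Finset.sum_eq_zero fun i _ => ?_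
    by_cases hi : δ i = 0
    · rw [hx i hi, zero_mul]
    · rw [hr i hi, mul_zero]
  -- For δ in place of α the sign condition is void whatever the signs of `x`, and (x, δ - x) = -(x,
  -- x).
  have h2 := kac_inequality h0 hc hx fun i => by
    by_cases hi : δ i = 0
    · rw [hx i hi]; simp
    · rw [hr i hi, mul_zero]
  rw [cartanForm_sub_right, h1, zero_sub] at h2
  exact ⟨by linarith [h2.1], fun h => (h2.2 (by rw [h, neg_zero])).1⟩

/-- In the case of equality the ratio y_i / α_i is constant on supp α and different from 0 and 1. So
every factor y_i(α_i - y_i) is nonzero there, which leaves (α, e_i) = 0. -/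
lemma cartanForm_sub_nonpos {α y : V → ℤ} (hα : α ∈ fundamentalRegion V) (h0 : 0 ≤ y)
    (h1 : y ≤ α) : cartanForm y (α - y) ≤ 0 ∧ (cartanForm y (α - y) = 0 → y ≠ 0 → y ≠ α →
      (∀ i j, y i * α j = y j * α i) ∧ ∀ i, α i ≠ 0 → cartanForm α (coordVec i) = 0) := by
  have hk := kac_inequality (y := y) hα.1 hα.2.2.1
    (fun i hi => le_antisymm (hi ▸ h1 i) (h0 i)) fun i =>
      mul_nonpos_of_nonneg_of_nonpos (mul_nonneg (h0 i) (sub_nonneg.mpr (h1 i))) (hα.2.2.2 i)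
  refine ⟨hk.1, fun heq hy0 hyα => ?_⟩
  obtain ⟨hp, hz⟩ := hk.2 heq
  refine ⟨hp, fun i hi => ?_⟩
  obtain ⟨j, hj⟩ := Function.ne_iff.mp hy0
  obtain ⟨k, hk⟩ := Function.ne_iff.mp hyα
  have hyi : y i ≠ 0 := fun h => by
    have := hp i j
    rw [h, zero_mul] at this
    exact mul_ne_zero hj hi this.symm
  have hyi2 : α i - y i ≠ 0 := fun h => by
    have h2 : α i = y i := by omega
    have := hp i k
    rw [h2] at this
    have h3 : y i * (α k - y k) = 0 := by linarith
    rcases mul_eq_zero.mp h3 with h3 | h3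
    · exact hyi h3
    · exact hk (by omega)
  exact (mul_eq_zero.mp (hz i)).resolve_left (mul_ne_zero hyi hyi2)

end Kac

/-! ### Null vectors below two overlapping summands. -/

section Null

/-- The hypothesis that all splittings of `α` have negative pairing. -/
def SplitsNeg (α : V → ℤ) : Prop :=
  ∀ y : V → ℤ, 0 ≤ y → y ≤ α → y ≠ 0 → y ≠ α → cartanForm y (α - y) < 0

/-- If (m, e_i) > 0, the negative pairing for the splitting at m - e_i forces (m, e_i) = 1 and (α,
e_i) = 0. Then m - e_i is again null with pairing -1 against α, and the descent on the height ends
with no positive pairing left. -/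
lemma exists_null_of_null {α μ : V → ℤ} (hα : α ∈ fundamentalRegion V) (H : SplitsNeg α)
    (hμα : μ < α) (m : V → ℤ) (h0 : 0 ≤ m) (hne : m ≠ 0) (hmμ : m ≤ μ) (hm : cartanForm m m = 0)
    (hmα : cartanForm m α = -1) :
    ∃ δ, 0 ≤ δ ∧ δ ≠ 0 ∧ δ ≤ μ ∧ cartanForm δ δ = 0 ∧ cartanForm δ α = -1 ∧
      ∀ i, cartanForm δ (coordVec i) ≤ 0 := by
  obtain ⟨n, hn⟩ : ∃ n : ℕ, ∑ i, m i < n := ⟨(∑ i, m i).toNat + 1, by omega⟩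
  induction n generalizing m with
  | zero =>
    have := sum_nonneg_of_nonneg h0
    push_cast at hn; omega
  | succ n ih =>
    by_cases hF : ∀ i, cartanForm m (coordVec i) ≤ 0
    · exact ⟨m, h0, hne, hmμ, hm, hmα, hF⟩
    push Not at hF
    obtain ⟨i, hi⟩ := hF
    have hl := loopfree_of_cartanForm_pos h0 hi
    have hy0 : 0 ≤ m - coordVec i := sub_nonneg.mpr (coordVec_le h0 (pos_of_cartanForm_pos h0 hi))
    have hym : m - coordVec i ≤ m := sub_le_self _ (coordVec_nonneg i)
    have hyne : m - coordVec i ≠ 0 := by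
      intro h
      rw [sub_eq_zero.mp h, hl.cartanForm_self] at hm
      omega
    have h1 := H _ hy0 ((hym.trans hmμ).trans hμα.le) hyne
      (ne_of_lt ((hym.trans hmμ).trans_lt hμα))
    have h2 := hα.2.2.2 i
    have h3 := hl.cartanForm_self
    have h4 := cartanForm_comm m (coordVec i)
    have h5 := cartanForm_comm α (coordVec i)
    have e1 : cartanForm (m - coordVec i) (m - coordVec i) = 2 - 2 * cartanForm m (coordVec i) := by
      simp only [cartanForm_sub_left, cartanForm_sub_right]; omega
    have e2 : cartanForm (m - coordVec i) α = -1 - cartanForm α (coordVec i) := by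
      rw [cartanForm_sub_left]; omega
    rw [cartanForm_sub_right] at h1
    have e3 := sum_reflectVec i m
    have e4 : reflectVec i m = m - coordVec i := by
      rw [reflectVec, show cartanForm m (coordVec i) = 1 by omega, one_smul]
    rw [e4] at e3
    exact ih (m - coordVec i) hy0 hyne (hym.trans hmμ) (by omega) (by omega)
      (by push_cast at hn; omega)

lemma cartanForm_add_self (x y : V → ℤ) :
    cartanForm (x + y) (x + y) = cartanForm x x + 2 * cartanForm x y + cartanForm y y := by
  simp only [cartanForm_add_left, cartanForm_add_right, cartanForm_comm y x]; ring

/-- If `α = β + γ` with `(β, γ) = -1` and `β`, `γ` have a common vertex in their supports, then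
there is a null vector below both. -/
lemma exists_null {α β γ : V → ℤ} (hα : α ∈ fundamentalRegion V) (H : SplitsNeg α)
    (hβ : 0 ≤ β) (hγ : 0 ≤ γ) (hs : β + γ = α) (hβγ : cartanForm β γ = -1)
    (hne : ¬ ∀ i, β i = 0 ∨ γ i = 0) :
    ∃ δ, 0 ≤ δ ∧ δ ≠ 0 ∧ δ ≤ β ∧ δ ≤ γ ∧ cartanForm δ δ = 0 ∧ cartanForm δ α = -1 ∧
      ∀ i, cartanForm δ (coordVec i) ≤ 0 := by
  -- The remainders β - m and γ - m have disjoint supports, hence non-positive pairing. Together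
  -- with (m, α - m) < 0 and (β, γ) = -1 this gives (m, α - m) = -1.
  set m := β ⊓ γ with hm
  have hm0 : 0 ≤ m := le_inf hβ hγ
  have hmne : m ≠ 0 := by
    intro h
    refine hne fun i => ?_
    have h1 : min (β i) (γ i) = 0 := congrFun h i
    omega
  obtain ⟨u, hu⟩ : ∃ u, β = m + u := ⟨β - m, by abel⟩
  obtain ⟨v, hv⟩ : ∃ v, γ = m + v := ⟨γ - m, by abel⟩
  have hu0 : 0 ≤ u := by
    have : m ≤ β := inf_le_left
    rwa [hu, le_add_iff_nonneg_right] at this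
  have hv0 : 0 ≤ v := by
    have : m ≤ γ := inf_le_right
    rwa [hv, le_add_iff_nonneg_right] at this
  have huv : cartanForm u v ≤ 0 := by
    refine cartanForm_nonpos_of_disjoint hu0 hv0 fun i => ?_
    have h1 := congrFun hu i
    have h2 := congrFun hv i
    have h3 : m i = min (β i) (γ i) := rfl
    simp only [Pi.add_apply] at h1 h2
    omega
  have hαm : α = m + m + (u + v) := by rw [← hs, hu, hv]; abel
  have huv0 : 0 ≤ u + v := add_nonneg hu0 hv0
  have hmuv0 : 0 ≤ m + (u + v) := add_nonneg hm0 huv0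
  have hmα : m < α := by
    refine lt_of_le_of_ne ?_ fun h => hmne ?_
    · rw [hαm, add_assoc]; exact le_add_of_nonneg_right hmuv0
    · have h2 : m + (u + v) = 0 := by
        rw [hαm, add_assoc] at h
        exact left_eq_add.mp h
      exact le_antisymm (by rw [← h2]; exact le_add_of_nonneg_right huv0) hm0
  have h1 := H m hm0 hmα.le hmne hmα.ne
  have e1 : cartanForm m (α - m) = cartanForm m m + cartanForm m u + cartanForm m v := by
    rw [hαm, show m + m + (u + v) - m = m + u + v by abel, cartanForm_add_right,
      cartanForm_add_right]
  have e2 : cartanForm β γ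
      = cartanForm m m + cartanForm m u + cartanForm m v + cartanForm u v := by
    rw [hu, hv]
    simp only [cartanForm_add_left, cartanForm_add_right, cartanForm_comm u m]; ring
  have e3 : cartanForm m α = 2 * cartanForm m m + cartanForm m u + cartanForm m v := by
    rw [hαm]; simp only [cartanForm_add_right]; ring
  -- The splitting at 2m gives (m, m) ≥ 0, and 2m = α is excluded by parity. Since (m, α) = (m, m) -
  -- 1 ≤ 0 and (m, m) is even, m is null and (m, α) = -1.
  have hmm : 0 ≤ cartanForm m m := by
    obtain ⟨k, hk⟩ := even_cartanForm_self m
    by_cases h2 : m + m = α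
    · exfalso
      have : α - m = m := by rw [← h2]; abel
      rw [this] at h1 e1
      omega
    · have h3 := H (m + m) (add_nonneg hm0 hm0) (by rw [hαm]; exact le_add_of_nonneg_right huv0)
        (fun h => hmne (le_antisymm (by rw [← h]; exact le_add_of_nonneg_right hm0) hm0)) h2
      rw [hαm, show m + m + (u + v) - (m + m) = u + v by abel] at h3
      simp only [cartanForm_add_left, cartanForm_add_right] at h3
      omega
  have h4 := fundamentalRegion.cartanForm_nonpos hα hm0
  rw [cartanForm_comm] at h4
  obtain ⟨k, hk⟩ := even_cartanForm_self m
  obtain ⟨δ, d1, d2, d3, d4⟩ := exists_null_of_null hα H hmα m hm0 hmne le_rfl (by omega) (by omega)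
  exact ⟨δ, d1, d2, d3.trans inf_le_left, d3.trans inf_le_right, d4⟩

/-- A null vector `δ` with `(δ, α) = -1` has connected support, if all splittings of `α` have
negative pairing. -/
lemma connectedOn_of_null {α δ : V → ℤ} (H : SplitsNeg α) (h0 : 0 ≤ δ) (hne : δ ≠ 0) (hδα : δ ≤ α)
    (hδ : cartanForm δ δ = 0) (hα : cartanForm δ α = -1) :
    ConnectedOn (Function.support δ) := by
  rw [connectedOn_iff]
  refine ⟨Function.support_nonempty_iff.mpr hne, fun T hT hTn hTc => ?_⟩
  by_contra hTS
  obtain ⟨b, hb, hbT⟩ := Set.not_subset.mp hTS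
  obtain ⟨a, ha⟩ := hTn
  classical
  set x : V → ℤ := T.indicator δ with hx
  set y : V → ℤ := Tᶜ.indicator δ with hy
  have hxy : x + y = δ := Set.indicator_self_add_compl T δ
  have hx0 : 0 ≤ x := fun i => Set.indicator_nonneg (fun j _ => h0 j) i
  have hy0 : 0 ≤ y := fun i => Set.indicator_nonneg (fun j _ => h0 j) i
  have hxa : x a ≠ 0 := by rw [hx, Set.indicator_of_mem ha]; exact hT ha
  have hyb : y b ≠ 0 := by rw [hy, Set.indicator_of_mem hbT]; exact hb
  have hxyz : cartanForm x y = 0 := by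
    by_contra h
    obtain ⟨i, hi, j, hj, hij⟩ := exists_of_cartanForm_ne_zero h
    have hi' : i ∈ T := Set.mem_of_indicator_ne_zero hi
    have hj' : j ∈ Tᶜ := Set.mem_of_indicator_ne_zero hj
    refine hij (hTc i hi' j ?_ hj')
    rw [Function.mem_support, hy, Set.indicator_of_mem hj'] at hj
    exact hj
  have hxδ : x ≤ δ := by rw [← hxy]; exact le_add_of_nonneg_right hy0
  have hyδ : y ≤ δ := by rw [← hxy]; exact le_add_of_nonneg_left hx0
  have hxb : x b = 0 := Set.indicator_of_notMem hbT δ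
  have hya : y a = 0 := Set.indicator_of_notMem (by simpa using ha) δ
  have h1 := H x hx0 (hxδ.trans hδα) (fun h => hxa (congrFun h a)) fun h => by
    have h2 := congrFun h b
    have h3 := hδα b
    have h4 := h0 b
    rw [hxb] at h2
    rw [← h2] at h3
    exact hb (le_antisymm h3 h4)
  have h2 := H y hy0 (hyδ.trans hδα) (fun h => hyb (congrFun h b)) fun h => by
    have h2 := congrFun h a
    have h3 := hδα a
    have h4 := h0 a
    rw [hya] at h2
    rw [← h2] at h3
    exact hT ha (le_antisymm h3 h4)
  -- The orthogonal parts satisfy (x, α) ≤ (x, x) - 1 and (y, α) ≤ (y, y) - 1; the sum would read -1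
  -- ≤ -2.
  rw [← hxy, cartanForm_add_self] at hδ
  rw [← hxy, cartanForm_add_left] at hα
  rw [cartanForm_sub_right] at h1 h2
  omega

end Null

/-! ### Rigidity at an extending vertex of an affine quiver. -/

section Radical

/-- If `f` pairs with the vertices of an affine quiver as `e_{j'}^* - e_j^*`, where `j` is an
extending vertex, then `j = j'`. -/
lemma eq_of_cartanForm_eq_sub {δ f : V → ℤ} (h0 : 0 ≤ δ)
    (hc : ConnectedOn (Function.support δ))
    (hr : ∀ i, δ i ≠ 0 → cartanForm δ (coordVec i) = 0) (hf : ∀ i, δ i = 0 → f i = 0)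
    {j j' : V} (hj : δ j = 1)
    (hfj : ∀ i, δ i ≠ 0 →
      cartanForm f (coordVec i) = (if i = j' then 1 else 0) - if i = j then 1 else 0) :
    j = j' := by
  by_contra hne
  have hsum : ∀ z : V → ℤ, (∀ i, δ i = 0 → z i = 0) →
      ∑ i, δ i * cartanForm z (coordVec i) = 0 := fun z hz => by
    rw [← cartanForm_eq_sum, cartanForm_comm, cartanForm_eq_sum]
    refine Finset.sum_eq_zero fun i _ => ?_
    by_cases hi : δ i = 0
    · rw [hz i hi, zero_mul]
    · rw [hr i hi, mul_zero]
  -- The δ-weighted sum of the pairings (z, e_i) is zero. If none is negative, all vanish, z is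
  -- null, and z is the multiple of δ fixed by its entry at `j`.
  have hzero : ∀ z : V → ℤ, (∀ i, δ i = 0 → z i = 0) →
      (∀ i, δ i ≠ 0 → 0 ≤ cartanForm z (coordVec i)) → z = z j • δ := fun z hz hz2 => by
    have h1 : ∀ i, 0 ≤ δ i * cartanForm z (coordVec i) := fun i => by
      by_cases hi : δ i = 0
      · simp [hi]
      · exact mul_nonneg (h0 i) (hz2 i hi)
    have h2 := (Finset.sum_eq_zero_iff_of_nonneg fun i _ => h1 i).mp (hsum z hz)
    have h3 : cartanForm z z = 0 := by
      rw [cartanForm_eq_sum]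
      refine Finset.sum_eq_zero fun i hi => ?_
      by_cases hδi : δ i = 0
      · rw [hz i hδi, zero_mul]
      · rw [(mul_eq_zero.mp (h2 i hi)).resolve_left hδi, mul_zero]
    funext i
    have := (cartanForm_self_nonneg_of_radical h0 hc hr hz).2 h3 i j
    rw [hj, mul_one] at this
    simpa using this
  -- This meet has non-negative pairings, so it is f_j δ. Hence f ≥ f_j δ, and subtracting gives g ≥
  -- 0 with g_j = 0 and the same pairings.
  set z := f ⊓ (f j • δ) with hz
  have hzi : ∀ i, z i = min (f i) (f j * δ i) := fun i => rfl
  have hz0 : ∀ i, δ i = 0 → z i = 0 := fun i hi => by simp [hzi, hf i hi, hi]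
  have hzj : z j = f j := by simp [hzi, hj]
  have hz1 : z = f j • δ := by
    rw [← hzj]
    refine hzero z hz0 fun i hi => ?_
    by_cases hle : z i = f j * δ i
    · have := cartanForm_coordVec_anti (x := z) (y := f j • δ) inf_le_right (v := i) hle
      rwa [cartanForm_smul_left, hr i hi, mul_zero] at this
    · have hzf : z i = f i := by have := hzi i; omega
      have hij : i ≠ j := by
        rintro rfl; apply hle; rw [hzj, hj, mul_one]
      have := cartanForm_coordVec_anti (x := z) (y := f) inf_le_left (v := i) hzf
      rw [hfj i hi, if_neg hij] at this
      split_ifs at this <;> omega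
  set g := f - f j • δ with hg
  have hg0 : 0 ≤ g := sub_nonneg.mpr (by rw [← hz1]; exact inf_le_left)
  have hgδ : ∀ i, δ i = 0 → g i = 0 := fun i hi => by simp [hg, hi, hf i hi]
  have hgj : g j = 0 := by simp [hg, hj]
  have hge : ∀ i, δ i ≠ 0 →
      cartanForm g (coordVec i) = (if i = j' then 1 else 0) - if i = j then 1 else 0 := by
    intro i hi
    rw [hg, cartanForm_sub_left, cartanForm_smul_left, hr i hi, hfj i hi]; ring
  set y := g ⊓ δ with hy
  have hyi : ∀ i, y i = min (g i) (δ i) := fun i => rfl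
  have hy0 : 0 ≤ y := le_inf hg0 h0
  have hyδ : ∀ i, δ i = 0 → y i = 0 := fun i hi => by simp [hyi, hgδ i hi, hi]
  have hyj : y j = 0 := by simp [hyi, hgj, hj]
  have hj0 : δ j ≠ 0 := by omega
  have hypos : ∀ i, δ i ≠ 0 → i ≠ j → 0 ≤ cartanForm y (coordVec i) := fun i hi hij => by
    by_cases hle : y i = δ i
    · have := cartanForm_coordVec_anti (x := y) (y := δ) inf_le_right (v := i) hle
      rwa [hr i hi] at this
    · have hyg : y i = g i := by have := hyi i; omega
      have := cartanForm_coordVec_anti (x := y) (y := g) inf_le_left (v := i) hyg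
      rw [hge i hi, if_neg hij] at this
      split_ifs at this <;> omega
  have hyj1 : -1 ≤ cartanForm y (coordVec j) := by
    have := cartanForm_coordVec_anti (x := y) (y := g) inf_le_left (v := j) (by rw [hyj, hgj])
    rw [hge j hj0, if_neg hne, if_pos rfl] at this
    omega
  -- Otherwise y is a multiple of δ with y_j = 0, hence zero; then g = 0, against (g, e_j) = -1.
  have hyneg : cartanForm y (coordVec j) < 0 := by
    by_contra hcon
    push Not at hcon
    have h1 := hzero y hyδ fun i hi => by
      by_cases hij : i = j
      · rw [hij]; exact hcon
      · exact hypos i hi hij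
    rw [hyj, zero_smul] at h1
    have h2 : g = 0 := by
      funext i
      by_cases hi : δ i = 0
      · exact hgδ i hi
      · have h3 := congrFun h1 i
        rw [hyi] at h3
        have := h0 i
        simp only [Pi.zero_apply] at this h3 ⊢
        omega
    have h3 := hge j hj0
    rw [h2, cartanForm_zero_left, if_neg hne, if_pos rfl] at h3
    omega
  have hyj2 : cartanForm y (coordVec j) = -1 := by omega
  -- The term at `j` contributes -1 to a weighted sum equal to zero, so the other terms add up to 1;
  -- the added indicator of `j` cancels that -1.
  obtain ⟨i₁, hi₁, hi₂⟩ := exists_of_sum_eq_one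
    (f := fun i => δ i * cartanForm y (coordVec i) + if i = j then 1 else 0)
    (fun i => by
      by_cases hij : i = j
      · subst hij; simp [hj, hyj2]
      · simp only [hij, if_false, add_zero]
        by_cases hi : δ i = 0
        · simp [hi]
        · exact mul_nonneg (h0 i) (hypos i hi hij))
    (by rw [Finset.sum_add_distrib, hsum y hyδ]; simp)
  have hij : i₁ ≠ j := by
    rintro rfl; simp [hj, hyj2] at hi₁
  simp only [hij, if_false, add_zero] at hi₁
  obtain ⟨h1, h2⟩ := eq_one_of_mul_eq_one (h0 i₁) hi₁
  have hyy : cartanForm y y = y i₁ := by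
    rw [cartanForm_eq_sum, Finset.sum_eq_single i₁]
    · rw [h2, mul_one]
    · intro i _ hi
      by_cases hij : i = j
      · rw [hij, hyj, zero_mul]
      · have h3 := hi₂ i hi
        simp only [hij, if_false, add_zero] at h3
        rcases mul_eq_zero.mp h3 with h3 | h3
        · rw [hyδ i h3, zero_mul]
        · rw [h3, mul_zero]
    · simp
  -- Here (y, y) = y_{i₁} is even and at most δ_{i₁} = 1, hence 0. But a vanishing entry is
  -- incompatible with the pairing (y, e_{i₁}) = 1.
  obtain ⟨k, hk⟩ := even_cartanForm_self y
  have h3 := hyi i₁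
  have h4 : 0 ≤ y i₁ := hy0 i₁
  have := cartanForm_coordVec_nonpos_of_eq_zero hy0 (v := i₁) (by omega)
  omega

end Radical

/-! ### Cases (a) and (b), and the decompositions they correspond to. -/

section Splitting

lemma UniqueArrowBetween.cartanForm_eq {J K : Set V} {j k : V} (h : UniqueArrowBetween J K j k)
    (hJK : Disjoint J K) {x y : V} (hx : x ∈ J) (hy : y ∈ K) :
    cartanForm (coordVec x) (coordVec y) = if x = j ∧ y = k then -1 else 0 := by
  have hxy : x ≠ y := fun e => Set.disjoint_left.mp hJK hx (e ▸ hy)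
  rw [cartanForm_coordVec_of_ne hxy, h.2.2 x hx y hy]
  split_ifs <;> simp

/-- The pairing of a vector supported on `J` with a vertex of `K`. -/
lemma UniqueArrowBetween.cartanForm_coordVec {J K : Set V} {j k : V}
    (h : UniqueArrowBetween J K j k) (hJK : Disjoint J K) {x : V → ℤ}
    (hx : Function.support x ⊆ J) {l : V} (hl : l ∈ K) :
    cartanForm x (coordVec l) = if l = k then -x j else 0 := by
  rw [cartanForm_coordVec_eq_sum, Finset.sum_eq_single j]
  · rw [h.cartanForm_eq hJK h.1 hl]
    simp
  · intro i _ hij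
    by_cases hi : i ∈ J
    · rw [h.cartanForm_eq hJK hi hl]; simp [hij]
    · rw [Function.notMem_support.mp fun h => hi (hx h), zero_mul]
  · simp

lemma UniqueArrowBetween.symm {J K : Set V} {j k : V} (h : UniqueArrowBetween J K j k) :
    UniqueArrowBetween K J k j := by
  refine ⟨h.2.1, h.1, fun x hx y hy => ?_⟩
  rw [add_comm, h.2.2 y hy x hx]
  simp only [and_comm]

/-- If two vectors with disjoint supports pair to `-1`, there is a unique arrow between their
supports. -/
lemma exists_uniqueArrowBetween {x y : V → ℤ} (hx : 0 ≤ x) (hy : 0 ≤ y)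
    (hd : ∀ i, x i = 0 ∨ y i = 0) (h : cartanForm x y = -1) :
    ∃ j k, x j = 1 ∧ y k = 1 ∧
      UniqueArrowBetween (Function.support x) (Function.support y) j k := by
  have hneg : ∀ l, y l ≠ 0 → ∀ i, 0 ≤ x i * -cartanForm (coordVec i) (coordVec l) :=
    fun l hl i => by
      by_cases hil : i = l
      · rw [hil, (hd l).resolve_right hl, zero_mul]
      · have := cartanForm_coordVec_nonpos hil
        exact mul_nonneg (hx i) (by omega)
  have hsum : ∀ l, ∑ i, x i * -cartanForm (coordVec i) (coordVec l)
      = -cartanForm x (coordVec l) := fun l => by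
    rw [cartanForm_coordVec_eq_sum x]
    simp only [mul_neg, Finset.sum_neg_distrib]
  obtain ⟨k, hk, hk'⟩ := exists_of_sum_eq_one (f := fun l => y l * -cartanForm x (coordVec l))
    (fun l => by
      by_cases hl : y l = 0
      · simp [hl]
      · rw [← hsum]
        exact mul_nonneg (hy l) (Finset.sum_nonneg fun i _ => hneg l hl i))
    (by rw [cartanForm_eq_sum] at h
        simp only [mul_neg, Finset.sum_neg_distrib, h, neg_neg])
  obtain ⟨hk1, hk2⟩ := eq_one_of_mul_eq_one (hy k) hk
  have hk0 : y k ≠ 0 := by omega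
  obtain ⟨j, hj, hj'⟩ := exists_of_sum_eq_one
    (f := fun i => x i * -cartanForm (coordVec i) (coordVec k)) (hneg k hk0)
    (by rw [hsum, hk2])
  obtain ⟨hj1, hj2⟩ := eq_one_of_mul_eq_one (hx j) hj
  refine ⟨j, k, hj1, hk1, by simp [hj1], hk0, fun a ha b hb => ?_⟩
  have hab : a ≠ b := by
    rintro rfl
    rcases hd a with h | h
    · exact ha h
    · exact hb h
  have hcard := cartanForm_coordVec_of_ne hab
  by_cases hbk : b = k
  · subst hbk
    by_cases haj : a = j
    · subst haj
      rw [if_pos ⟨rfl, rfl⟩]; omega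
    · have := (mul_eq_zero.mp (hj' a haj)).resolve_left ha
      rw [if_neg (by simp [haj])]; omega
  · have h1 := (mul_eq_zero.mp (hk' b hbk)).resolve_left hb
    rw [← hsum] at h1
    have h2 := (Finset.sum_eq_zero_iff_of_nonneg fun i _ => hneg b hb i).mp h1 a
      (Finset.mem_univ a)
    have h3 := (mul_eq_zero.mp h2).resolve_left ha
    rw [if_neg (by simp [hbk])]; omega

lemma disjoint_support_of_forall {x y : V → ℤ} (hd : ∀ i, x i = 0 ∨ y i = 0) :
    Disjoint (Function.support x) (Function.support y) :=
  Set.disjoint_left.mpr fun i hi hi' => (hd i).elim hi hi'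

lemma isAffineDynkinOn_support {δ : V → ℤ} (h0 : 0 ≤ δ)
    (hc : ConnectedOn (Function.support δ))
    (hr : ∀ i, δ i ≠ 0 → cartanForm δ (coordVec i) = 0) (hne : δ ≠ 0) :
    IsAffineDynkinOn (Function.support δ) := by
  refine ⟨hc, fun x hx => ?_, δ, subset_rfl, hne, ?_⟩
  · have := (cartanForm_self_nonneg_of_radical (x := x) h0 hc hr fun i hi => by
      by_contra h; exact hx h hi).1
    rw [cartanForm_self] at this
    omega
  · have : cartanForm δ δ = 0 := by
      rw [cartanForm_eq_sum]
      refine Finset.sum_eq_zero fun i _ => ?_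
      by_cases hi : δ i = 0
      · simp [hi]
      · rw [hr i hi, mul_zero]
    rw [cartanForm_self] at this
    omega

/-- Disjoint supports give (b1). Overlapping supports give a null vector δ in the fundamental
region, whose support is affine; α restricted to it is then shown to be a multiple of δ, which is
(b2). -/
lemma Triple.caseB_of_split {t : Triple V} {β γ : V → ℤ} (hα : t.α ∈ fundamentalRegion V)
    (H : SplitsNeg t.α) (hβ : β ∈ RPlus t.q t.θ) (hγ : γ ∈ RPlus t.q t.θ) (hs : β + γ = t.α)
    (hβγ : cartanForm β γ = -1) : t.CaseB := by
  have hβ' := (mem_RPlus_iff.mp hβ).1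
  have hγ' := (mem_RPlus_iff.mp hγ).1
  have hs' : ∀ i, t.α i = β i + γ i := fun i => (congrFun hs i).symm
  by_cases hd : ∀ i, β i = 0 ∨ γ i = 0
  · obtain ⟨j, k, hj, hk, hu⟩ := exists_uniqueArrowBetween hβ'.nonneg hγ'.nonneg hd hβγ
    refine ⟨Function.support β, Function.support γ, j, k, disjoint_support_of_forall hd, ?_, hu, ?_,
      .inl ⟨?_, ?_⟩⟩
    · rw [← hs, support_add_of_nonneg hβ'.nonneg hγ'.nonneg]
    · have := hd k; have := hs' k; omega
    · have := hd j; have := hs' j; omega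
    · convert hβ using 1
      funext i
      by_cases hi : β i = 0
      · rw [Set.indicator_of_notMem (by simpa using hi), hi]
      · rw [Set.indicator_of_mem hi, hs', (hd i).resolve_left hi, add_zero]
  obtain ⟨δ, h0, hne, hδβ, hδγ, hδδ, hδα, hδF⟩ :=
    exists_null hα H hβ'.nonneg hγ'.nonneg hs hβγ hd
  have hβα : β ≤ t.α := by rw [← hs]; exact le_add_of_nonneg_right hγ'.nonneg
  have hc := connectedOn_of_null H h0 hne (hδβ.trans hβα) hδδ hδα
  have hδfund : δ ∈ fundamentalRegion V := ⟨h0, hne, hc, hδF⟩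
  have hr : ∀ i, δ i ≠ 0 → cartanForm δ (coordVec i) = 0 := fun i hi => by
    rw [cartanForm_eq_sum] at hδδ
    have := (Finset.sum_eq_zero_iff_of_nonpos fun i _ =>
      mul_nonpos_of_nonneg_of_nonpos (h0 i) (hδF i)).mp hδδ i (Finset.mem_univ i)
    exact (mul_eq_zero.mp this).resolve_left hi
  -- the vertex of `supp δ` at which `α` pairs non-trivially
  obtain ⟨j, hj, hj'⟩ := exists_of_sum_eq_one (f := fun i => δ i * -cartanForm t.α (coordVec i))
    (fun i => mul_nonneg (h0 i) (neg_nonneg.mpr (hα.2.2.2 i)))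
    (by rw [cartanForm_comm, cartanForm_eq_sum] at hδα
        simp only [mul_neg, Finset.sum_neg_distrib, hδα, neg_neg])
  obtain ⟨hj1, hj2⟩ := eq_one_of_mul_eq_one (h0 j) hj
  have hαe : ∀ i, δ i ≠ 0 → cartanForm t.α (coordVec i) = if i = j then -1 else 0 := by
    intro i hi
    by_cases hij : i = j
    · rw [if_pos hij, hij]; omega
    · have := (mul_eq_zero.mp (hj' i hij)).resolve_left hi
      rw [if_neg hij]; omega
  classical
  set J := Function.support δ with hJ
  set f := J.indicator t.α with hf
  set g := Jᶜ.indicator t.α with hg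
  have hfg : f + g = t.α := Set.indicator_self_add_compl J t.α
  have hf0 : 0 ≤ f := fun i => Set.indicator_nonneg (fun j _ => hα.1 j) i
  have hg0 : 0 ≤ g := fun i => Set.indicator_nonneg (fun j _ => hα.1 j) i
  have hfJ : ∀ i, δ i ≠ 0 → f i = t.α i := fun i hi => Set.indicator_of_mem hi _
  have hfJ' : ∀ i, δ i = 0 → f i = 0 := fun i hi =>
    Set.indicator_of_notMem (by simpa [hJ] using hi) _
  have hgJ : ∀ i, δ i ≠ 0 → g i = 0 := fun i hi =>
    Set.indicator_of_notMem (by simpa [hJ] using hi) _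
  have hgJ' : ∀ i, δ i = 0 → g i = t.α i := fun i hi =>
    Set.indicator_of_mem (by simpa [hJ] using hi) _
  have hδf : cartanForm δ f = 0 := by
    rw [cartanForm_eq_sum]
    refine Finset.sum_eq_zero fun i _ => ?_
    by_cases hi : δ i = 0
    · rw [hfJ' i hi, zero_mul]
    · rw [hr i hi, mul_zero]
  have hδg : cartanForm δ g = -1 := by
    rw [← hfg, cartanForm_add_right] at hδα; omega
  have hdδ : ∀ i, δ i = 0 ∨ g i = 0 := fun i => by
    by_cases hi : δ i = 0
    · exact .inl hi
    · exact .inr (hgJ i hi)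
  obtain ⟨j', k, hj'1, hk1, hu⟩ := exists_uniqueArrowBetween h0 hg0 hdδ hδg
  have hdisj := disjoint_support_of_forall hdδ
  have hkδ : δ k = 0 := (hdδ k).resolve_right (by omega)
  have hαk : t.α k = 1 := by rw [← hgJ' k hkδ, hk1]
  -- The vertex `j` is where α pairs to -1 on supp δ, while `j'` is where the arrow to the rest of
  -- supp α starts. The rigidity at extending vertices identifies them, so that `f` becomes radical
  -- on supp δ and hence a multiple of δ.
  have hfe : ∀ i, δ i ≠ 0 →
      cartanForm f (coordVec i) = (if i = j' then 1 else 0) - if i = j then 1 else 0 := by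
    intro i hi
    have h1 := hαe i hi
    have h2 := hu.symm.cartanForm_coordVec hdisj.symm (x := g) subset_rfl (l := i) hi
    rw [← hfg, cartanForm_add_left, h2, hk1] at h1
    split_ifs at h1 ⊢ <;> omega
  have hjj' : j = j' := eq_of_cartanForm_eq_sub h0 hc hr hfJ' hj1 hfe
  subst hjj'
  have hff : cartanForm f f = 0 := by
    rw [cartanForm_eq_sum]
    refine Finset.sum_eq_zero fun i _ => ?_
    by_cases hi : δ i = 0
    · rw [hfJ' i hi, zero_mul]
    · rw [hfe i hi, sub_self, mul_zero]
  have hj0 : δ j ≠ 0 := by omega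
  have hfδ : ∀ i, f i = t.α j * δ i := fun i => by
    have := (cartanForm_self_nonneg_of_radical h0 hc hr hfJ').2 hff i j
    rwa [hj1, mul_one, hfJ j hj0] at this
  -- the summand without the vertex `k` is `δ`
  have key : ∀ x y : V → ℤ, IncRoot x → x + y = t.α → 0 ≤ y → cartanForm x y = -1 →
      δ ≤ x → x k = 0 → x = δ := by
    intro x y hx hxy hy0 hxy1 hδx hxk
    -- The only arrow leaving `J` within supp α ends at `k`, where `x` vanishes, so connectedness
    -- keeps `x` inside `J`.
    have hxJ : Function.support x ⊆ Function.support x ∩ J := by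
      refine (connectedOn_iff.mp hx.connectedOn).2 _ Set.inter_subset_left
        ⟨j, ?_, hj0⟩ fun i hi l hl hl' => ?_
      · have : δ j ≤ x j := hδx j
        rw [Function.mem_support]; omega
      · have hlJ : δ l = 0 := by
          by_contra h; exact hl' ⟨hl, h⟩
        have hlg : l ∈ Function.support g := by
          rw [Function.mem_support, hgJ' l hlJ, ← hxy, Pi.add_apply]
          have h1 := hx.nonneg l
          have h2 := hy0 l
          have h3 : x l ≠ 0 := hl
          simp only [Pi.zero_apply] at h1 h2
          omega
        rw [hu.cartanForm_eq hdisj hi.2 hlg, if_neg]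
        rintro ⟨_, rfl⟩
        exact hl hxk
    have hx0 : ∀ i, δ i = 0 → x i = 0 := fun i hi => by
      by_contra h; exact (hxJ h).2 hi
    have hxα : cartanForm t.α x = -x j := by
      rw [cartanForm_eq_sum, Finset.sum_eq_single j]
      · rw [hαe j hj0]; simp
      · intro i _ hij
        by_cases hi : δ i = 0
        · rw [hx0 i hi, zero_mul]
        · rw [hαe i hi, if_neg hij, mul_zero]
      · simp
    obtain ⟨h1, h2⟩ := cartanForm_self_nonneg_of_radical h0 hc hr hx0
    have h3 : δ j ≤ x j := hδx j
    rw [cartanForm_comm, ← hxy, cartanForm_add_right] at hxα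
    -- From (x, α) = -x_j and (x, y) = -1 one gets (x, x) = 1 - x_j, while (x, x) ≥ 0 and x_j ≥ δ_j
    -- = 1. So `x` is null and equals δ.
    have h4 : x j = 1 := by omega
    funext i
    have := h2 (by omega) i j
    rwa [hj1, mul_one, h4, one_mul] at this
  have hδR : δ ∈ RPlus t.q t.θ := by
    have h1 := hs' k
    have h2 := hβ'.nonneg k
    have h3 := hγ'.nonneg k
    simp only [Pi.zero_apply] at h2 h3
    obtain h4 | h4 : β k = 0 ∨ γ k = 0 := by omega
    · rwa [← key β γ hβ' hs hγ'.nonneg hβγ hδβ h4]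
    · rwa [← key γ β hγ' (by rw [add_comm, hs]) hβ'.nonneg (by rw [cartanForm_comm, hβγ]) hδγ h4]
  have hαj : 2 ≤ t.α j := by
    have h1 : δ j ≤ β j := hδβ j
    have h2 : δ j ≤ γ j := hδγ j
    have := hs' j
    omega
  refine ⟨J, Function.support g, j, k, hdisj, ?_, hu, hαk, .inr
    ⟨isAffineDynkinOn_support h0 hc hr hne, δ, (t.α j).toNat,
      ⟨h0, ⟨δ, hδfund, [], by simp, .inl rfl⟩, subset_rfl, ?_⟩, hδR, hj1, by omega, ?_⟩⟩
  · ext i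
    by_cases hi : δ i = 0
    · simp [hJ, hi, hgJ' i hi]
    · have h1 : δ i ≤ β i := hδβ i
      have h2 : 0 ≤ δ i := h0 i
      have h3 : β i ≤ t.α i := hβα i
      have : t.α i ≠ 0 := by omega
      simp [hJ, hi, this]
  · refine Finset.normalize_gcd.symm.trans (normalize_eq_one.mpr ?_)
    exact isUnit_of_dvd_one (hj1 ▸ Finset.gcd_dvd (Finset.mem_univ j))
  · funext i
    rw [← natCast_zsmul, Int.toNat_of_nonneg (by omega)]
    exact hfδ i

/-- Write α = nδ with δ indivisible; then β = bδ with 0 < b < n. The order ℓ of q^δ divides both b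
and n, so n = mℓ with m ≥ 2. -/
lemma Triple.caseA_of_radical {t : Triple V} {β : V → ℤ} (hα : t.α ∈ fundamentalRegion V)
    (hN : t.α ∈ NSet t.q t.θ) (hr : ∀ i, t.α i ≠ 0 → cartanForm t.α (coordVec i) = 0)
    (hβ : β ∈ NSet t.q t.θ) (hβ0 : β ≠ 0) (hβα : β ≤ t.α) (hne : β ≠ t.α)
    (hp : ∀ i j, β i * t.α j = β j * t.α i) : t.CaseA := by
  obtain ⟨i₀, hi₀⟩ := Function.ne_iff.mp hα.2.1
  obtain ⟨δ, hδ, hgcd⟩ := Finset.extract_gcd t.α (s := Finset.univ) ⟨i₀, Finset.mem_univ _⟩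
  set n := Finset.univ.gcd t.α with hn
  have hαδ : t.α = n • δ := funext fun i => hδ i (Finset.mem_univ i)
  have hn0 : 0 < n := by
    refine lt_of_le_of_ne (Int.nonneg_of_normalize_eq_self Finset.normalize_gcd) fun h => ?_
    rw [← h, zero_smul] at hαδ
    exact hα.2.1 hαδ
  have hδ0 : 0 ≤ δ := fun i => by
    have h1 : 0 ≤ n * δ i := by
      have := hα.1 i
      rw [hαδ] at this
      exact this
    exact nonneg_of_mul_nonneg_right h1 hn0
  have hsupp : Function.support t.α = Function.support δ := by
    rw [hαδ]; ext i; simp [hn0.ne']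
  have hcδ : ConnectedOn (Function.support δ) := hsupp ▸ hα.2.2.1
  have hδne : δ ≠ 0 := by
    rintro rfl
    rw [smul_zero] at hαδ
    exact hα.2.1 hαδ
  have hF : ∀ i, cartanForm δ (coordVec i) ≤ 0 := fun i => by
    have := hα.2.2.2 i
    rw [hαδ, cartanForm_smul_left] at this
    exact nonpos_of_mul_nonpos_right this hn0
  have hrδ : ∀ i, δ i ≠ 0 → cartanForm δ (coordVec i) = 0 := fun i hi => by
    have hi' : i ∈ Function.support t.α := by rw [hsupp]; exact hi
    have := hr i hi'
    rw [hαδ, cartanForm_smul_left] at this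
    exact (mul_eq_zero.mp this).resolve_left hn0.ne'
  have hpδ : ∀ i j, β i * δ j = β j * δ i := fun i j => by
    have := hp i j
    rw [hαδ] at this
    simp only [Pi.smul_apply, smul_eq_mul] at this
    refine mul_left_cancel₀ hn0.ne' ?_
    linarith
  obtain ⟨a, ha⟩ := Function.ne_iff.mp hδne
  -- By proportionality δ_a divides every β_a δ_j, and the δ_j have greatest common divisor 1.
  have hdvd : δ a ∣ β a := by
    have h1 : δ a ∣ Finset.univ.gcd fun j => β a * δ j :=
      Finset.dvd_gcd fun j _ => ⟨β j, by rw [hpδ a j, mul_comm]⟩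
    rw [Finset.gcd_mul_left, hgcd, mul_one] at h1
    exact (dvd_normalize_iff).mp h1
  obtain ⟨b, hb⟩ := hdvd
  have hβδ : β = b • δ := by
    funext i
    refine mul_right_cancel₀ ha ?_
    rw [hpδ i a, hb, Pi.smul_apply, smul_eq_mul]; ring
  have hδa : 0 < δ a := lt_of_le_of_ne (hδ0 a) (Ne.symm ha)
  have hb0 : 0 < b := by
    have h1 : 0 ≤ β a := hβ.1 a
    rw [hb] at h1
    refine lt_of_le_of_ne (nonneg_of_mul_nonneg_right h1 hδa) fun h => hβ0 ?_
    rw [hβδ, ← h, zero_smul]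
  have hbn : b < n := by
    have h1 : b * δ a ≤ n * δ a := by
      have := hβα a
      rw [hβδ, hαδ] at this
      exact this
    refine lt_of_le_of_ne (le_of_mul_le_mul_right h1 hδa) fun h => hne ?_
    rw [hβδ, hαδ, h]
  have hqn : qPow t.q δ ^ n = 1 := by
    rw [← qPow_zsmul, ← hαδ]; exact hN.2.1
  have hqb : qPow t.q δ ^ b = 1 := by
    rw [← qPow_zsmul, ← hβδ]; exact hβ.2.1
  obtain ⟨m, hm⟩ := orderOf_dvd_iff_zpow_eq_one.mpr hqn
  obtain ⟨c, hc⟩ := orderOf_dvd_iff_zpow_eq_one.mpr hqb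
  set ℓ := orderOf (qPow t.q δ) with hℓ
  have hℓ0 : (0 : ℤ) < ℓ := by
    rcases Nat.eq_zero_or_pos ℓ with h | h
    · rw [h] at hc; simp at hc; omega
    · exact_mod_cast h
  have hc0 : 0 < c := by
    rw [hc] at hb0; exact pos_of_mul_pos_right hb0 hℓ0.le
  have hcm : c < m := by
    rw [hc, hm] at hbn; exact lt_of_mul_lt_mul_left hbn hℓ0.le
  refine ⟨Function.support δ, δ, m.toNat, ℓ, isAffineDynkinOn_support hδ0 hcδ hrδ hδne,
    ⟨hδ0, ⟨δ, ⟨hδ0, hδne, hcδ, hF⟩, [], by simp, .inl rfl⟩, subset_rfl, hgcd⟩, by omega,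
    by omega, IsPrimitiveRoot.orderOf _, ?_⟩
  rw [hαδ, hm, ← natCast_zsmul]
  push_cast
  rw [Int.toNat_of_nonneg (by omega), mul_comm]

lemma IsAffineDynkinOn.eulerForm_eq_zero {J : Set V} {δ : V → ℤ} (hJ : IsAffineDynkinOn J)
    (hδ : IsIndivImaginaryRootOn J δ) : eulerForm δ δ = 0 :=
  le_antisymm hδ.2.1.eulerForm_nonpos (hJ.2.1 δ hδ.2.2.1)

/-- The `m` summands ℓδ have p = 1 each, against p(α) = 1. -/
lemma Triple.CaseA.notMem_FlatSet {t : Triple V} (h : t.CaseA) (hN : t.α ∈ NSet t.q t.θ) :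
    t.α ∉ FlatSet t.q t.θ := by
  obtain ⟨J, δ, m, ℓ, hJ, hδ, hm, hℓ, hq, hα⟩ := h
  have he := hJ.eulerForm_eq_zero hδ
  have hα' : t.α = (m : ℤ) • ((ℓ : ℤ) • δ) := by
    rw [hα, ← natCast_zsmul, smul_smul]; push_cast; rfl
  have hp : ∀ n : ℤ, pFun (n • δ) = 1 := fun n => by
    rw [pFun, eulerForm_smul_left, eulerForm_smul_right, he]; ring
  have hR : (ℓ : ℤ) • δ ∈ RPlus t.q t.θ := by
    have h0 : 0 ≤ (ℓ : ℤ) • δ := smul_nonneg (by omega) hδ.1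
    refine ⟨⟨h0, .inr (hδ.2.1.smul (by omega))⟩, h0, ?_, ?_⟩
    · rw [qPow_zsmul, zpow_natCast, hq.pow_eq_one]
    · have h1 := hN.2.2
      rw [hα'] at h1
      simp only [Pi.smul_apply, smul_eq_mul, mul_assoc, ← Finset.mul_sum] at h1 ⊢
      exact (mul_eq_zero.mp h1).resolve_left (by omega)
  intro hF
  have := hF.2 (List.replicate m ((ℓ : ℤ) • δ)) (fun β hβ => List.eq_of_mem_replicate hβ ▸ hR)
    (by rw [List.sum_replicate, hα', natCast_zsmul _ m])
  rw [hα', smul_smul, hp, List.map_replicate, List.sum_replicate, hp] at this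
  simp at this
  omega

lemma SigmaSet_subset_FlatSet (q : V → ℂˣ) (θ : V → ℤ) : SigmaSet q θ ⊆ FlatSet q θ := by
  intro x hx
  refine ⟨hx.1.2, fun l hl hs => ?_⟩
  match l with
  | [] =>
    exact absurd hs.symm (mem_RPlus_iff.mp hx.1).1.ne_zero
  | [β] =>
    simp only [List.sum_cons, List.sum_nil, add_zero] at hs
    simp [hs]
  | β :: γ :: l => exact (hx.2 _ (by simp) hl hs).le

/-- With x = α|_J and y = α|_K one has (x, y) = -α_j, so p(α) = p(x) + p(y) - 1 + α_j. This is the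
total p of x + y in (b1), and of `y` with `m` copies of δ in (b2), where p(x) = 1 and α_j = m. -/
lemma Triple.CaseB.notMem_SigmaSet {t : Triple V} (h : t.CaseB) (hα : t.α ∈ fundamentalRegion V)
    (hN : t.α ∈ NSet t.q t.θ) : t.α ∉ SigmaSet t.q t.θ := by
  obtain ⟨J, K, j, k, hd, hS, hu, hk, h⟩ := h
  classical
  set x := J.indicator t.α with hx
  set y := K.indicator t.α with hy
  have hx0 : 0 ≤ x := fun i => Set.indicator_nonneg (fun j _ => hα.1 j) i
  have hy0 : 0 ≤ y := fun i => Set.indicator_nonneg (fun j _ => hα.1 j) i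
  have hxJ : Function.support x ⊆ J := Set.support_indicator_subset
  have hKS : K ⊆ Function.support t.α := by rw [hS]; exact Set.subset_union_right
  have hyK : Function.support y = K := by
    rw [hy, Set.support_indicator, Set.inter_eq_left]; exact hKS
  have hxy : x + y = t.α := by
    refine (Set.indicator_union_of_disjoint hd t.α).symm.trans ?_
    rw [← hS, Set.indicator_support]
  have hxj : x j = t.α j := Set.indicator_of_mem hu.1 _
  have hyk : y k = 1 := by rw [← hk]; exact Set.indicator_of_mem hu.2.1 _
  -- A cut of `K` containing `k` is enlarged by `J` to a cut of supp α; one without `k` is itself a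
  -- cut of supp α.
  have hKc : ConnectedOn K := by
    rw [connectedOn_iff]
    refine ⟨⟨k, hu.2.1⟩, fun T hT hTn hTc => ?_⟩
    have hαc := (connectedOn_iff.mp hα.2.2.1).2
    by_cases hkT : k ∈ T
    · have := hαc (T ∪ J) ?_ (hTn.mono Set.subset_union_left) ?_
      · intro i hi
        exact (this (hKS hi)).resolve_right (Set.disjoint_right.mp hd hi)
      · rw [hS, Set.union_comm]; exact Set.union_subset_union_right _ hT
      · rintro i hi l hl hlT
        rw [hS] at hl
        have hlK : l ∈ K := hl.resolve_left fun h => hlT (.inr h)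
        rcases hi with hi | hi
        · exact hTc i hi l hlK fun h => hlT (.inl h)
        · rw [hu.cartanForm_eq hd hi hlK, if_neg]
          rintro ⟨_, rfl⟩
          exact hlT (.inl hkT)
    · refine absurd (hαc T (hT.trans hKS) hTn ?_ (hKS hu.2.1)) hkT
      intro i hi l hl hlT
      rw [hS] at hl
      rcases hl with hl | hl
      · rw [cartanForm_comm, hu.cartanForm_eq hd hl (hT hi), if_neg]
        rintro ⟨_, rfl⟩
        exact hkT hi
      · exact hTc i hi l hl hlT
  have hyR : IncRoot y := by
    refine incRoot_of_apply_eq_one hy0 (by rwa [hyK]) hyk fun i hik => ?_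
    by_cases hi : i ∈ K
    · have h1 := hu.cartanForm_coordVec hd hxJ hi
      rw [if_neg hik] at h1
      have h2 := hα.2.2.2 i
      rwa [← hxy, cartanForm_add_left, h1, zero_add] at h2
    · exact cartanForm_coordVec_nonpos_of_eq_zero hy0 (Set.indicator_of_notMem hi _)
  have hxyj : cartanForm x y = -t.α j := by
    rw [cartanForm_eq_sum, Finset.sum_eq_single k]
    · rw [hyk, hu.cartanForm_coordVec hd hxJ hu.2.1, if_pos rfl, hxj, one_mul]
    · intro i _ hik
      by_cases hi : i ∈ K
      · rw [hu.cartanForm_coordVec hd hxJ hi, if_neg hik, mul_zero]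
      · rw [hy, Set.indicator_of_notMem hi, zero_mul]
    · simp
  have hpα : pFun t.α = pFun x + pFun y - 1 + t.α j := by
    rw [← hxy, pFun_add, hxyj, hxy]; ring
  intro hSig
  rcases h with ⟨hj, hxR⟩ | ⟨hJ, δ, m, hδ, hδR, hδj, hm, hxδ⟩
  · have hyN : y ∈ NSet t.q t.θ := NSet.of_add_left (x := x) hxR.2 (by rwa [hxy]) hy0
    have := hSig.2 [x, y] (by simp) ?_ (by simpa using hxy)
    · simp only [List.map_cons, List.map_nil, List.sum_cons, List.sum_nil] at this
      omega
    · intro β hβ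
      simp only [List.mem_cons, List.not_mem_nil, or_false] at hβ
      rcases hβ with rfl | rfl
      · exact hxR
      · exact mem_RPlus_iff.mpr ⟨hyR, hyN⟩
  · have he := hJ.eulerForm_eq_zero hδ
    have hxδ' : x = (m : ℤ) • δ := by rw [hx, hxδ, natCast_zsmul]
    have hxN : x ∈ NSet t.q t.θ := by rw [hxδ']; exact NSet.smul hδR.2 (by omega)
    have hyN : y ∈ NSet t.q t.θ := NSet.of_add_left hxN (by rwa [hxy]) hy0
    have hpδ : pFun δ = 1 := by rw [pFun, he]; ring
    have hpx : pFun x = 1 := by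
      rw [hxδ', pFun, eulerForm_smul_left, eulerForm_smul_right, he]; ring
    have hαj : t.α j = m := by
      rw [← hxj, hxδ', Pi.smul_apply, hδj]; simp
    have := hSig.2 (y :: List.replicate m δ) (by simp; omega) ?_ ?_
    · rw [List.map_cons, List.map_replicate, List.sum_cons, List.sum_replicate, hpδ] at this
      simp at this
      omega
    · intro β hβ
      rcases List.mem_cons.mp hβ with rfl | hβ
      · exact mem_RPlus_iff.mpr ⟨hyR, hyN⟩
      · rwa [List.eq_of_mem_replicate hβ]
    · rw [List.sum_cons, List.sum_replicate, ← natCast_zsmul, ← hxδ', add_comm, hxy]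

end Splitting

/-! ### Merging decompositions, and the last vector of a sequence. -/

section Decompositions

lemma cartanForm_multiset_sum_nonneg {x : V → ℤ} {s : Multiset (V → ℤ)}
    (h : ∀ y ∈ s, 0 ≤ cartanForm x y) : 0 ≤ cartanForm x s.sum := by
  induction s using Multiset.induction_on with
  | empty => simp [cartanForm_zero_right]
  | cons a s ih =>
    rw [Multiset.sum_cons, cartanForm_add_right]
    exact add_nonneg (h a (Multiset.mem_cons_self a s))
      (ih fun y hy => h y (Multiset.mem_cons_of_mem hy))

lemma multiset_sum_nonneg_ne_zero {s : Multiset (V → ℤ)} (hs : ∀ y ∈ s, IncRoot y)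
    (hne : s ≠ 0) : 0 ≤ s.sum ∧ s.sum ≠ 0 := by
  obtain ⟨a, ha⟩ := Multiset.exists_mem_of_ne_zero hne
  obtain ⟨r, rfl⟩ := Multiset.exists_cons_of_mem ha
  have hr : 0 ≤ r.sum :=
    Multiset.sum_nonneg fun y hy => (hs y (Multiset.mem_cons_of_mem hy)).nonneg
  have h1 : a ≤ (a ::ₘ r).sum := by rw [Multiset.sum_cons]; exact le_add_of_nonneg_right hr
  have h2 := hs a (Multiset.mem_cons_self a r)
  exact ⟨h2.nonneg.trans h1, fun h => h2.ne_zero (le_antisymm (h ▸ h1) h2.nonneg)⟩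

/-- Merging the summands of a decomposition with `∑ p(β⁽ⁱ⁾) ≥ p(α)` leads to a splitting into two
vectors. -/
lemma exists_split {q : V → ℂˣ} {θ α : V → ℤ} (s : Multiset (V → ℤ))
    (hs : ∀ y ∈ s, y ∈ RPlus q θ) (hcard : 2 ≤ s.card) (hsum : s.sum = α)
    (hp : pFun α ≤ (s.map pFun).sum) :
    ∃ β γ : V → ℤ, β ∈ RPlus q θ ∧ 0 ≤ γ ∧ γ ≠ 0 ∧ β + γ = α ∧
      (0 ≤ cartanForm β γ ∨
        γ ∈ RPlus q θ ∧ cartanForm β γ = -1 ∧ (s.map pFun).sum ≤ pFun α) := by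
  obtain ⟨n, hn⟩ : ∃ n, s.card = n := ⟨_, rfl⟩
  induction n using Nat.strong_induction_on generalizing s with
  | _ n ih =>
  subst hn
  obtain ⟨β, hβ⟩ := Multiset.exists_mem_of_ne_zero (s := s) (by rintro rfl; simp at hcard)
  obtain ⟨r, rfl⟩ := Multiset.exists_cons_of_mem hβ
  rw [Multiset.card_cons] at hcard
  have hβR := hs β hβ
  have hrR : ∀ y ∈ r, y ∈ RPlus q θ := fun y hy => hs y (Multiset.mem_cons_of_mem hy)
  -- If `β` pairs non-negatively with every other summand, it does so with their sum, and merging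
  -- stops here.
  by_cases h : ∀ γ ∈ r, 0 ≤ cartanForm β γ
  · obtain ⟨h1, h2⟩ := multiset_sum_nonneg_ne_zero
      (fun y hy => (mem_RPlus_iff.mp (hrR y hy)).1) (s := r) (by rintro rfl; simp at hcard)
    exact ⟨β, r.sum, hβR, h1, h2, by rw [← hsum, Multiset.sum_cons],
      .inl (cartanForm_multiset_sum_nonneg h)⟩
  push Not at h
  obtain ⟨γ, hγ, hneg⟩ := h
  obtain ⟨r, rfl⟩ := Multiset.exists_cons_of_mem hγ
  have hγR := hrR γ hγ
  have hpadd := pFun_add β γ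
  simp only [Multiset.sum_cons, Multiset.map_cons] at hsum hp ⊢
  by_cases hr : r = 0
  · subst hr
    simp only [Multiset.sum_zero, Multiset.map_zero, add_zero] at hsum hp ⊢
    rw [hsum] at hpadd
    have hγI := (mem_RPlus_iff.mp hγR).1
    exact ⟨β, γ, hβR, hγI.nonneg, hγI.ne_zero, hsum, .inr ⟨hγR, by omega, by omega⟩⟩
  · have hrc : 0 < r.card := Multiset.card_pos.mpr hr
    -- Merging a pair with (β, γ) ≤ -1 does not lower the total p. This both keeps the hypothesis
    -- and carries the final bound ∑ p ≤ p(α) back to the original decomposition.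
    have hle : pFun β + (pFun γ + (r.map pFun).sum) ≤ (((β + γ) ::ₘ r).map pFun).sum := by
      rw [Multiset.map_cons, Multiset.sum_cons]; omega
    have hmem : ∀ y ∈ (β + γ) ::ₘ r, y ∈ RPlus q θ := fun y hy => by
      rcases Multiset.mem_cons.mp hy with rfl | hy
      · exact RPlus.add hβR hγR hneg
      · exact hrR y (Multiset.mem_cons_of_mem hy)
    obtain ⟨b, c, h1, h2, h3, h4, h5⟩ := ih (r.card + 1) (by simp) ((β + γ) ::ₘ r) hmem
      (by rw [Multiset.card_cons]; omega) (by rw [Multiset.sum_cons, add_assoc, hsum])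
      (hp.trans hle) (by simp)
    exact ⟨b, c, h1, h2, h3, h4, h5.imp_right fun h => ⟨h.1, h.2.1, hle.trans h.2.2⟩⟩

lemma Triple.case_of_decomposition {t : Triple V} (hα : t.α ∈ fundamentalRegion V)
    (hN : t.α ∈ NSet t.q t.θ) (l : List (V → ℤ)) (hl : ∀ y ∈ l, y ∈ RPlus t.q t.θ)
    (hlen : 2 ≤ l.length) (hsum : l.sum = t.α) (hp : pFun t.α ≤ (l.map pFun).sum) :
    t.CaseA ∨ t.CaseB ∧ (l.map pFun).sum ≤ pFun t.α := by
  obtain ⟨β, γ, hβ, hγ0, hγne, hs, h⟩ := exists_split (l : Multiset (V → ℤ))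
    (by simpa using hl) (by simpa using hlen) (by simpa using hsum) (by simpa using hp)
  have hβI := (mem_RPlus_iff.mp hβ).1
  have hβα : β ≤ t.α := by rw [← hs]; exact le_add_of_nonneg_right hγ0
  have hγeq : t.α - β = γ := by rw [← hs]; abel
  have hne : β ≠ t.α := fun h => hγne (by rw [← hγeq, h, sub_self])
  rcases h with h | ⟨hγ, hβγ, hple⟩
  · left
    obtain ⟨h1, h2⟩ := cartanForm_sub_nonpos hα hβI.nonneg hβα
    obtain ⟨h3, h4⟩ := h2 (le_antisymm h1 (by rwa [hγeq])) hβI.ne_zero hne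
    exact Triple.caseA_of_radical hα hN h4 (mem_RPlus_iff.mp hβ).2 hβI.ne_zero hβα hne h3
  · right
    refine ⟨Triple.caseB_of_split hα (fun y hy0 hyα hyne hyne' => ?_) hβ hγ hs hβγ,
      by simpa using hple⟩
    obtain ⟨h1, h2⟩ := cartanForm_sub_nonpos hα hy0 hyα
    refine lt_of_le_of_ne h1 fun h => ?_
    have hr := (h2 h hyne hyne').2
    -- A splitting with pairing zero would make α radical on its support. Then (β, β) = -(β, γ) = 1,
    -- which is odd.
    have h3 : cartanForm t.α β = 0 := by
      rw [cartanForm_eq_sum]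
      refine Finset.sum_eq_zero fun i _ => ?_
      by_cases hi : t.α i = 0
      · have h4 : β i ≤ t.α i := hβα i
        have h5 : 0 ≤ β i := hβI.nonneg i
        rw [show β i = 0 by omega, zero_mul]
      · rw [hr i hi, mul_zero]
    rw [cartanForm_comm, ← hs, cartanForm_add_right] at h3
    obtain ⟨m, hm⟩ := even_cartanForm_self β
    omega

lemma Triple.notMem_iff_of_mem_fundamentalRegion {t : Triple V}
    (hα : t.α ∈ fundamentalRegion V) (hR : t.α ∈ RPlus t.q t.θ) :
    (t.α ∉ SigmaSet t.q t.θ ↔ t.CaseA ∨ t.CaseB) ∧ (t.α ∉ FlatSet t.q t.θ ↔ t.CaseA) := by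
  have hN := (mem_RPlus_iff.mp hR).2
  refine ⟨⟨fun h => ?_, ?_⟩, fun h => ?_, fun h => h.notMem_FlatSet hN⟩
  · by_contra hcon
    push Not at hcon
    refine h ⟨hR, fun l hlen hl hsum => ?_⟩
    by_contra hp
    rcases Triple.case_of_decomposition hα hN l hl hlen hsum (not_lt.mp hp) with h1 | h1
    · exact hcon.1 h1
    · exact hcon.2 h1.1
  · rintro (h | h)
    · exact fun h1 => h.notMem_FlatSet hN (SigmaSet_subset_FlatSet _ _ h1)
    · exact h.notMem_SigmaSet hα hN
  · by_contra hcon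
    refine h ⟨hN, fun l hl hsum => ?_⟩
    by_contra hp
    push Not at hp
    have hlen : 2 ≤ l.length := by
      match l with
      | [] => exact absurd hsum.symm hα.2.1
      | [β] =>
        simp only [List.sum_cons, List.sum_nil, add_zero] at hsum
        simp [hsum] at hp
      | β :: γ :: l => simp
    -- Case (b) comes with ∑ p ≤ p(α), contrary to the assumed violation of flatness.
    rcases Triple.case_of_decomposition hα hN l hl hlen hsum hp.le with h1 | h1
    · exact hcon h1
    · omega

lemma length_le_sum {l : List (V → ℤ)} (hl : ∀ y ∈ l, IncRoot y) :
    (l.length : ℤ) ≤ ∑ i, l.sum i := by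
  induction l with
  | nil => simp
  | cons a l ih =>
    have h1 := ih fun y hy => hl y (List.mem_cons_of_mem a hy)
    have h2 := hl a (by simp)
    have h3 : 0 < ∑ i, a i := by
      refine lt_of_le_of_ne (sum_nonneg_of_nonneg h2.nonneg) fun h => h2.ne_zero (funext fun i => ?_)
      exact (Finset.sum_eq_zero_iff_of_nonneg fun i _ => h2.nonneg i).mp h.symm i
        (Finset.mem_univ i)
    simp only [List.sum_cons, Pi.add_apply, Finset.sum_add_distrib, List.length_cons]
    push_cast
    omega

/-- A vector of height one is not a sum of two positive roots, and its height rules out (a) as well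
as the two disjoint support pieces in (b). -/
lemma Triple.notMem_iff_of_eq_coordVec {t : Triple V} {v : V} (hα : t.α = coordVec v)
    (hR : t.α ∈ RPlus t.q t.θ) :
    (t.α ∉ SigmaSet t.q t.θ ↔ t.CaseA ∨ t.CaseB) ∧ (t.α ∉ FlatSet t.q t.θ ↔ t.CaseA) := by
  have hSig : t.α ∈ SigmaSet t.q t.θ := by
    refine ⟨hR, fun l hlen hl hsum => ?_⟩
    have := length_le_sum fun y hy => (mem_RPlus_iff.mp (hl y hy)).1
    rw [hsum, hα] at this
    simp [coordVec] at this
    omega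
  have hA : ¬ t.CaseA := by
    rintro ⟨J, δ, m, ℓ, -, hδ, hm, hℓ, -, h⟩
    have h1 := congrFun h v
    rw [hα, coordVec_self, Pi.smul_apply, ← natCast_zsmul, smul_eq_mul] at h1
    have h2 := eq_one_of_mul_eq_one (by positivity) h1.symm
    have h3 : m * ℓ = 1 := by exact_mod_cast h2.1
    have := Nat.eq_one_of_mul_eq_one_right h3
    omega
  have hB : ¬ t.CaseB := by
    rintro ⟨J, K, j, k, hd, hS, hu, -⟩
    rw [hα, support_coordVec] at hS
    have h1 : j ∈ ({v} : Set V) := hS ▸ .inl hu.1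
    have h2 : k ∈ ({v} : Set V) := hS ▸ .inr hu.2.1
    rw [Set.mem_singleton_iff] at h1 h2
    exact Set.disjoint_left.mp hd hu.1 (h1.trans h2.symm ▸ hu.2.1)
  have hF := SigmaSet_subset_FlatSet _ _ hSig
  tauto

end Decompositions

end MultQuiver

end

theorem theorem5p9 {V : Type u} [Fintype V] [DecidableEq V] [Quiver.{w} V]
    [∀ i j : V, Fintype (i ⟶ j)] (q : V → ℂˣ) (θ α : V → ℤ)
    (hα : α ∈ MultQuiver.RPlus q θ) :
    (∃ vs : List V, (MultQuiver.Triple.mk q θ α).IsReflectingSequence vs) ∧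
    ∀ vs : List V, (MultQuiver.Triple.mk q θ α).IsReflectingSequence vs →
      (α ∉ MultQuiver.SigmaSet q θ ↔
        (∃ i : Fin vs.length, ¬ ((MultQuiver.Triple.mk q θ α).after vs i).Admissible vs[i]) ∨
          ((MultQuiver.Triple.mk q θ α).final vs).CaseA ∨
          ((MultQuiver.Triple.mk q θ α).final vs).CaseB) ∧
      (α ∉ MultQuiver.FlatSet q θ ↔
        (∃ i : Fin vs.length, ¬ ((MultQuiver.Triple.mk q θ α).after vs i).Admissible vs[i] ∧
            ¬ ((MultQuiver.Triple.mk q θ α).after vs i).MinusOne vs[i]) ∨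
          ((MultQuiver.Triple.mk q θ α).final vs).CaseA) := by
  refine ⟨(MultQuiver.mem_RPlus_iff.mp hα).1.exists_isReflectingSequence q θ, fun vs hvs => ?_⟩
  obtain ⟨h1, h2, h3⟩ := MultQuiver.notMem_iff_of_isReflectingSequence vs _ hvs hα
  obtain ⟨h4, h5⟩ : (_ ∧ _) := by
    rcases hvs.2.1 with h | ⟨v, h⟩
    · exact MultQuiver.Triple.notMem_iff_of_mem_fundamentalRegion h h1
    · exact MultQuiver.Triple.notMem_iff_of_eq_coordVec h h1
  rw [h4] at h2
  rw [h5] at h3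
  exact ⟨h2, h3⟩
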